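/- **Corollary 2 (C.d.f. and moments).** Let $\omega,\alpha,\beta>0$, $\lambda\ge 0$, and consider the GJR-GARCH(1,1) process $$x_t=\sigma_t\varepsilon_t,\qquad \sigma_t^2=\omega+\alpha_{t-1}x_{t-1}^2+\beta\sigma_{t-1}^2,\qquad \alpha_t=\alpha+\lambda 1_{x_t<0},\qquad t\ge 1,$$ with $\sigma_t>0$ and $\varepsilon_1,\varepsilon_2,\dots$ i.i.d. $N(0,1)$, independent of the initial pair $(x_0,\sigma_0)$. Put $z_t=x_t^2$, let $h\ge 2$ be an integer, and let the prediction law (c.d.f. $F$, moments $E$) of $x_h$ and of $z_h$ be the conditional law given $(x_0,\sigma_0)$, so that $\sigma_1^2=\omega+\alpha_0x_0^2+\beta\sigma_0^2$ is known. Let $\theta=\omega/(2\sigma_1^2)$ and $\underline\beta=-\theta+\sqrt{\theta^2+2\theta}$, and assume $\beta\ge\underline\beta$ if $h=3$ and $\beta\ge\max(\tfrac12,\underline\beta)$ if $h>3$ (nothing if $h=2$). Let $\mathcal S=\{-1,1\}^{h-1}$; for $s=(s_1,\dots,s_{h-1})\in\mathcal S$ put $\alpha_t=\alpha+\frac\lambda2(1-s_t)$.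 Let $\Psi(a,c;z)=\frac1{\Gamma(a)}\int_0^\infty e^{-zt}t^{a-1}(1+t)^{c-a-1}\,dt$ for $a,z>0$. For indices $k_1,\dots,k_{h-2}$ put $K_t=\sum_{i\le t}k_i$, $S_t=\sum_{i\le t}(i-1)k_i$ and $\psi_t(j,u)=\Psi(\frac12,1-j-K_t;u)$. For real $j$ let $m_j=-\frac12-j$ if this is a natural number and $m_j=\infty$ otherwise, and $$c_{j,s}=\pi^{\frac{h-1}2}(\sigma_1^2\alpha_{h-1})^{-\frac12}(\omega+\beta\sigma_1^2)^{-j}\sum_{k_1=0}^{m_j}\sum_{k_2=0}^{m_j-k_1}\cdots\sum_{k_{h-2}=0}^{m_j-K_{h-3}}\psi_{h-2}\Big(j,\tfrac{\omega+\beta\sigma_1^2}{2\alpha_1\sigma_1^2}\Big)\,\omega^{K_{h-2}}\beta^{S_{h-2}-(K_{h-2}+j)(h-2)}(\omega+\beta\sigma_1^2)^{-K_{h-2}}\prod_{t=1}^{h-2}\binom{-\frac12-j-K_{t-1}}{k_t}\alpha_t^{-\frac12}\,\psi_t\Big(j,\tfrac{\beta}{2\alpha_{h-t}}\Big)$$ (for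 $h=2$ there are no summation indices, and the iterated sum is $\psi_0(j,\frac{\omega+\beta\sigma_1^2}{2\alpha_1\sigma_1^2})$). Let $c_j=2^{-h+1}\sum_{s\in\mathcal S}c_{j,s}$. Then, for almost every value of $(x_0,\sigma_0)$ for which the assumption holds: 1. If moreover $\beta\ne\underline\beta$ in case $h>2$, then for every natural number $j$ and every $s$ each of the iterated series in $c_{j,s}$ converges, and $$F_{z_h}(w)=(2\pi)^{-\frac h2}\sum_{j=0}^\infty\frac{(-2)^{-j}}{j!\,(j+\frac12)}\,w^{j+\frac12}c_j\quad(w\ge 0),\qquad F_{x_h}(u)=\frac12+(2\pi)^{-\frac h2}\sum_{j=0}^\infty\frac{(-2)^{-j}}{j!\,(2j+1)}\,u^{2j+1}c_j\quad(u\in\mathbb R),$$ both series being absolutely convergent. 2. For $m=1,2,\dots$ the moments $E(x_h^{2m})$ and $E(z_h^m)$ are finite and $$E(x_h^{2m})=E(z_h^m)=2^{m+\frac32-\frac32h}\,\pi^{-\frac h2}\,\Gamma(m+\tfrac12)\sum_{s\in\mathcal S}c_{-m-\frac12,s}.$$ Here $c_{-m-\frac12,s}$ is a finite sum, over the $(k_1,\dots,k_{h-2})$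 with $k_1+\dots+k_{h-2}\le m$, and the Tricomi functions in it are finite sums too: for integers $0\le k\le m$ and $\xi>0$, $$\Psi\big(\tfrac12,\tfrac32+m-k;\xi\big)=\frac{\Gamma(m+\frac12)}{\sqrt\pi\,k!\,\binom{m-\frac12}{k}}\,\xi^{-\frac12-m+k}\sum_{i=0}^{m-k}\frac{\binom{m-k}{i}}{\binom{-\frac12+m-k}{i}}\,\frac{\xi^i}{i!}.$$ -/

import Mathlib

open MeasureTheory ProbabilityTheory

noncomputable section

/-- The ARCH coefficient `α_t = α + λ 1_{x_t < 0}` as a function of the value `u` of `x_t`. -/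
def gjrAlpha (α lam u : ℝ) : ℝ := α + lam * (if u < 0 then 1 else 0)

/-- The asymmetric GJR-GARCH(1,1) process started at time `0` from the observed (possibly random)
pair `(x 0, σ 0)` and driven by i.i.d. standard Gaussian innovations `ε 1, ε 2, …`, which are
independent of the time-zero information `(x 0, σ 0)`. The value `ε 0` plays no role. -/
structure IsGJRGarch {Ω : Type*} [MeasurableSpace Ω] (μ : Measure Ω) (ω α β lam : ℝ)
    (x σ ε : ℕ → Ω → ℝ) : Prop where
  measurable_x_zero : Measurable (x 0)
  measurable_σ_zero : Measurable (σ 0)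
  measurable_ε : ∀ t, Measurable (ε (t + 1))
  law_ε : ∀ t, μ.map (ε (t + 1)) = gaussianReal 0 1
  indep_ε : iIndepFun (fun t => ε (t + 1)) μ
  indep_zero : IndepFun (fun o => (x 0 o, σ 0 o)) (fun o t => ε (t + 1) o) μ
  σ_pos : ∀ t o, 0 < σ t o
  x_succ : ∀ t o, x (t + 1) o = σ (t + 1) o * ε (t + 1) o
  σ_succ : ∀ t o,
    σ (t + 1) o ^ 2 = ω + gjrAlpha α lam (x t o) * x t o ^ 2 + β * σ t o ^ 2

/-- `σ_1²` as a function of the observed values `x₀`, `σ₀`. -/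
def sigmaOneSq (ω α β lam x₀ σ₀ : ℝ) : ℝ := ω + gjrAlpha α lam x₀ * x₀ ^ 2 + β * σ₀ ^ 2

/-- The lower bound `-θ + √(θ² + 2θ)`, with `θ = ω / (2 σ_1²)`; here `v = σ_1²`. -/
def betaLow (ω v : ℝ) : ℝ :=
  -(ω / (2 * v)) + Real.sqrt ((ω / (2 * v)) ^ 2 + 2 * (ω / (2 * v)))

/-- The condition on `β` for the horizon `h` (no condition if `h = 2`); here `v = σ_1²`. -/
def BetaAssumption (ω β v : ℝ) (h : ℕ) : Prop :=
  (h = 3 → betaLow ω v ≤ β) ∧ (3 < h → max (1 / 2) (betaLow ω v) ≤ β)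

/-- Tricomi's confluent hypergeometric function `Ψ(a, c; z)` for real `a, z > 0`. -/
def tricomi (a c z : ℝ) : ℝ :=
  (1 / Real.Gamma a) *
    ∫ t in Set.Ioi (0 : ℝ), Real.exp (-z * t) * t ^ (a - 1) * (1 + t) ^ (c - a - 1)

open Classical in
/-- The upper summation limit `b_r`: it is `r` if `r` is a natural number, and `∞` otherwise. -/
def upperLimit (r : ℝ) : ℕ∞ := if ∃ n : ℕ, r = n then (⌊r⌋₊ : ℕ∞) else ⊤

open Classical in
/-- The iterated sum `∑_{k_1=0}^{M} ∑_{k_2=0}^{M-k_1} ⋯ ∑_{k_n=0}^{M-k_1-⋯-k_{n-1}} f(k_1,…,k_n)`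
(each of the sums is an infinite series if `M = ∞`). -/
def iterSum : (n : ℕ) → ℕ∞ → ((Fin n → ℕ) → ℝ) → ℝ
  | 0, _, f => f Fin.elim0
  | n + 1, M, f => ∑' k : ℕ,
      if (k : ℕ∞) ≤ M then iterSum n (M - k) (fun k' => f (Fin.cons k k')) else 0

open Classical in
/-- Every one of the series in the iterated sum `iterSum n M f` converges (absolutely). -/
def IterSummable : (n : ℕ) → ℕ∞ → ((Fin n → ℕ) → ℝ) → Prop
  | 0, _, _ => True
  | n + 1, M, f =>
      (∀ k : ℕ, (k : ℕ∞) ≤ M → IterSummable n (M - k) (fun k' => f (Fin.cons k k'))) ∧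
      Summable (fun k : ℕ =>
        if (k : ℕ∞) ≤ M then iterSum n (M - k) (fun k' => f (Fin.cons k k')) else 0)

/-- `K_t = k_1 + ⋯ + k_t`; the entry `k i` stands for `k_{i+1}`. -/
def partialK {n : ℕ} (k : Fin n → ℕ) (t : ℕ) : ℕ := ∑ i : Fin n, if (i : ℕ) < t then k i else 0

/-- `S_t = ∑_{i=1}^t (i - 1) k_i`; the entry `k i` stands for `k_{i+1}`. -/
def partialS {n : ℕ} (k : Fin n → ℕ) (t : ℕ) : ℕ :=
  ∑ i : Fin n, if (i : ℕ) < t then (i : ℕ) * k i else 0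

/-- A sign vector `(s_1, …, s_{h-1})` with entries in `{-1, 1}`. -/
abbrev SignVec (h : ℕ) : Type := (Finset.Icc 1 (h - 1) : Finset ℕ) → ℤˣ

/-- `α_t = α + (λ / 2) (1 - s_t)` for `t = 1, …, h - 1`. -/
def signAlpha (α lam : ℝ) {h : ℕ} (s : SignVec h) (t : ℕ) : ℝ :=
  if ht : t ∈ Finset.Icc 1 (h - 1) then α + lam / 2 * (1 - (((s ⟨t, ht⟩ : ℤˣ) : ℤ) : ℝ)) else 0

/-- The summand with indices `k_1, …, k_{h-2}` in the coefficient `c_{j,s}`: with `v = σ_1²` and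
`a t = α_t`, and with the index `i` running over `t - 1 = 0, …, h - 3`, it is
`Ψ(1/2, 1-j-K_{h-2}; (ω+βv)/(2α_1v)) ω^{K_{h-2}} β^{S_{h-2}-(K_{h-2}+j)(h-2)} (ω+βv)^{-K_{h-2}}`
times
`∏_{t=1}^{h-2} binom(-1/2-j-K_{t-1}, k_t) α_t^{-1/2} Ψ(1/2, 1-j-K_t; β/(2α_{h-t}))`. -/
def coefTerm (ω β v : ℝ) (h : ℕ) (a : ℕ → ℝ) (j : ℝ) (k : Fin (h - 2) → ℕ) : ℝ :=
  tricomi (1 / 2) (1 - j - partialK k (h - 2)) ((ω + β * v) / (2 * a 1 * v)) *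
    ω ^ partialK k (h - 2) *
    β ^ ((partialS k (h - 2) : ℝ) - (partialK k (h - 2) + j) * ((h : ℝ) - 2)) *
    (ω + β * v) ^ (-(partialK k (h - 2) : ℝ)) *
    ∏ i : Fin (h - 2),
      (Ring.choose (-(1 / 2 : ℝ) - j - partialK k i) (k i) * a (i + 1) ^ (-(1 / 2 : ℝ)) *
        tricomi (1 / 2) (1 - j - partialK k (i + 1)) (β / (2 * a (h - (i + 1)))))

/-- The factor `π^{(h-1)/2} (v α_{h-1})^{-1/2} (ω + β v)^{-j}` of `c_{j,s}`; here `v = σ_1²`. -/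
def coefFactor (ω β v : ℝ) (h : ℕ) (a : ℕ → ℝ) (j : ℝ) : ℝ :=
  Real.pi ^ (((h : ℝ) - 1) / 2) * (v * a (h - 1)) ^ (-(1 / 2 : ℝ)) * (ω + β * v) ^ (-j)

/-- The coefficient `c_{j,s}`, for real `j` and horizon `h ≥ 2`. If `h = 2` there is no summation
index, and it is `π^{1/2} (v α_1)^{-1/2} (ω + β v)^{-j} Ψ(1/2, 1-j; (ω+βv)/(2α_1v))`. -/
def coef (ω β v : ℝ) (h : ℕ) (a : ℕ → ℝ) (j : ℝ) : ℝ :=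
  coefFactor ω β v h a j *
    iterSum (h - 2) (upperLimit (-(1 / 2) - j)) (coefTerm ω β v h a j)

/-- `c_j = 2^{-h+1} ∑_s c_{j,s}`. -/
def meanCoef (ω α β lam v : ℝ) (h : ℕ) (j : ℝ) : ℝ :=
  (2 : ℝ) ^ (-(h : ℝ) + 1) * ∑ s : SignVec h, coef ω β v h (signAlpha α lam s) j

end

/-! Given `(x₀, σ₀)`, the prediction law of `x_h` is the law of `√V ε`, where `V = σ_h²` is at least
`ω` and `ε` is an independent standard Gaussian. Integrating the odd power series of the Gaussian
c.d.f. at `u / √V` over the law of `V` expresses the c.d.f. through the moments `E V^(-1/2-j)`; the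
bound `V ≥ ω` justifies the interchange. Even moments of `x_h` are `E V^m` times Gaussian moments.
Both parts thus reduce to `E V^q` with `q = -1/2 - j`, where `j` is a natural number or `-m - 1/2`.

Since `ε` and `-ε` have the same law, the law of `V` is the average over sign vectors of laws with
deterministic ARCH coefficients `a t` (`varianceKernel_gjrAlpha_eq`). For such coefficients,
`σ_{t+1}² = ω + (a t ε_t² + β) σ_t²`. Expanding the `q`-th power by the binomial series in `ω` makes
each term factor by independence into a Gaussian integral, which is a Tricomi function, and a lower
moment of `σ_t²` (`hasSum_integral_varianceLaw_succ`). Iterating down to `σ_2²` gives the nested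
sums (`iterSum_momentTerm`), which are matched with `c_{j,s}` by `coefFactor_mul_coefTerm`.

The binomial series needs `ω < β σ_t²` almost surely, uniformly. With vanishing innovations `σ_2²`
attains its lower bound `ω + βv`; there the condition is `β > betaLow`, and `β ≥ 1/2` carries it to
later times. For natural `q` the expansion is finite and no such condition arises. -/

/-! ### Binomial series with a real exponent. -/

theorem summable_abs_choose_mul_pow (q : ℝ) {r : ℝ} (hr0 : 0 ≤ r) (hr : r < 1) :
    Summable fun k : ℕ => |Ring.choose q k| * r ^ k := by
  lift r to NNReal using hr0
  have h := (binomialSeries ℝ q).summable_norm_mul_pow (r := r)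
    (lt_of_lt_of_le (by exact_mod_cast hr) binomialSeries_radius_ge_one)
  refine h.congr fun k => ?_
  simp [binomialSeries]

theorem hasSum_choose_mul_pow (q : ℝ) {x : ℝ} (hx : |x| < 1) :
    HasSum (fun k : ℕ => Ring.choose q k * x ^ k) ((1 + x) ^ q) := by
  have h := (Real.one_add_rpow_hasFPowerSeriesOnBall_zero (a := q)).hasSum (y := x) (by
    rw [← ENNReal.ofReal_one, Metric.eball_ofReal]; simpa using hx)
  simpa [binomialSeries, FormalMultilinearSeries.coeff_ofScalars, mul_comm] using h

/-- The expansion is in `ω / y`, so each further power of `ω` lowers the exponent of `y` by one. -/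
theorem hasSum_add_rpow (q : ℝ) {ω y : ℝ} (hω : 0 ≤ ω) (hy : ω < y) :
    HasSum (fun k : ℕ => Ring.choose q k * ω ^ k * y ^ (q - k)) ((ω + y) ^ q) := by
  have hy0 : 0 < y := hω.trans_lt hy
  have h := (hasSum_choose_mul_pow q (x := ω / y) (by
    rw [abs_of_nonneg (by positivity), div_lt_one hy0]; exact hy)).mul_right (y ^ q)
  have e : (1 + ω / y) ^ q * y ^ q = (ω + y) ^ q := by
    rw [← Real.mul_rpow (by positivity) hy0.le]
    congr 1; field_simp; ring
  rw [e] at h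
  convert! h using 2 with k
  rw [Real.rpow_sub_natCast hy0.ne', div_pow]
  field_simp

/-- The product of the first two factors is a falling factorial, so this is the functional equation
of Gamma applied `k` times; the bound on `k` keeps every argument positive. -/
theorem choose_mul_factorial_mul_Gamma {r : ℝ} (k : ℕ) (hk : (k : ℝ) < r + 1) :
    Ring.choose r k * k.factorial * Real.Gamma (r + 1 - k) = Real.Gamma (r + 1) := by
  have hd : ∀ n : ℕ, Ring.choose r n * n.factorial = (descPochhammer ℤ n).smeval r := by
    intro n
    rw [Ring.descPochhammer_eq_factorial_smul_choose, nsmul_eq_mul, mul_comm]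
  rw [hd]
  induction k with
  | zero => simp
  | succ k ih =>
    push_cast at hk ⊢
    rw [← ih (by linarith), show r + 1 - (k : ℝ) = (r - k) + 1 by ring,
      Real.Gamma_add_one (by linarith), descPochhammer_succ_right, Polynomial.smeval_mul,
      Polynomial.smeval_sub, Polynomial.smeval_X, Polynomial.smeval_natCast,
      show r + 1 - ((k : ℝ) + 1) = r - k by ring]
    simp
    ring

/-! ### Gaussian integrals and Tricomi functions. -/

/-- The density is even, so twice the half line suffices; the Jacobian of `t = e²` supplies
`t^(-1/2)` and cancels the 2. -/
theorem integral_gaussianReal_comp_sq (f : ℝ → ℝ) :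
    ∫ e, f (e ^ 2) ∂(gaussianReal 0 1) =
      (2 * Real.pi) ^ (-(1 / 2 : ℝ)) *
        ∫ t in Set.Ioi (0 : ℝ), Real.exp (-t / 2) * t ^ (-(1 / 2 : ℝ)) * f t := by
  rw [integral_gaussianReal_eq_integral_smul (by simp)]
  have h1 : ∀ x : ℝ, gaussianPDFReal 0 1 x • f (x ^ 2) =
      (fun y : ℝ => (2 * Real.pi) ^ (-(1 / 2 : ℝ)) * (Real.exp (-(y ^ 2) / 2) * f (y ^ 2))) |x| := by
    intro x
    simp only [gaussianPDFReal, sq_abs, smul_eq_mul, NNReal.coe_one, sub_zero, mul_one]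
    rw [Real.sqrt_eq_rpow, ← Real.rpow_neg (by positivity)]
    ring
  simp_rw [h1]
  rw [integral_comp_abs (f := fun y : ℝ =>
    (2 * Real.pi) ^ (-(1 / 2 : ℝ)) * (Real.exp (-(y ^ 2) / 2) * f (y ^ 2))), integral_const_mul]
  rw [← integral_comp_rpow_Ioi (fun t => Real.exp (-t / 2) * t ^ (-(1 / 2 : ℝ)) * f t)
    (p := 2) two_ne_zero]
  rw [mul_left_comm, ← integral_const_mul]
  congr 1
  refine setIntegral_congr_fun measurableSet_Ioi fun x (hx : 0 < x) => ?_
  have h2 : (x ^ (2 : ℝ)) ^ (-(1 / 2 : ℝ)) = x⁻¹ := by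
    rw [← Real.rpow_mul hx.le]; norm_num [Real.rpow_neg_one]
  simp only [smul_eq_mul]
  rw [h2]
  norm_num
  field_simp

/-- After `t = e²`, rescaling `t` by `B / A` turns `B + A t` into `B (1 + t)`, which leaves the
Tricomi integrand. -/
theorem integral_gaussianReal_add_mul_sq_rpow {A B : ℝ} (hA : 0 < A) (hB : 0 < B) (q : ℝ) :
    ∫ e, (B + A * e ^ 2) ^ q ∂(gaussianReal 0 1) =
      2 ^ (-(1 / 2 : ℝ)) * A ^ (-(1 / 2 : ℝ)) * B ^ (q + 1 / 2) *
        tricomi (1 / 2) (q + 3 / 2) (B / (2 * A)) := by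
  rw [integral_gaussianReal_comp_sq (fun t => (B + A * t) ^ q), tricomi, Real.Gamma_one_half_eq]
  have hBA : 0 < B / A := by positivity
  have h := integral_comp_mul_left_Ioi'
    (fun t : ℝ => Real.exp (-t / 2) * t ^ (-(1 / 2 : ℝ)) * (B + A * t) ^ q) 0 hBA
  simp only [mul_zero] at h
  rw [← h]
  have h3 : ∀ t ∈ Set.Ioi (0 : ℝ), Real.exp (-(B / A * t) / 2) * (B / A * t) ^ (-(1 / 2 : ℝ)) *
      (B + A * (B / A * t)) ^ q = ((B / A) ^ (-(1 / 2 : ℝ)) * B ^ q) *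
      (Real.exp (-(B / (2 * A)) * t) * t ^ ((1 / 2 : ℝ) - 1) *
        (1 + t) ^ (q + 3 / 2 - 1 / 2 - 1)) := by
    intro t (ht : 0 < t)
    have e1 : B + A * (B / A * t) = B * (1 + t) := by field_simp
    rw [e1, Real.mul_rpow hB.le (by positivity), Real.mul_rpow hBA.le ht.le,
      show q + 3 / 2 - 1 / 2 - 1 = q by ring, show ((1 / 2 : ℝ) - 1) = -(1 / 2) by norm_num,
      show -(B / A * t) / 2 = -(B / (2 * A)) * t by field_simp]
    ring
  rw [setIntegral_congr_fun measurableSet_Ioi h3, integral_const_mul]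
  have e2 : (B / A) * (B / A) ^ (-(1 / 2 : ℝ)) = B ^ (1 / 2 : ℝ) * A ^ (-(1 / 2 : ℝ)) := by
    rw [← Real.rpow_one_add' hBA.le (by norm_num), Real.div_rpow hB.le hA.le, div_eq_mul_inv,
      ← Real.rpow_neg hA.le]
    norm_num
  have e3 : (2 * Real.pi) ^ (-(1 / 2 : ℝ)) = 2 ^ (-(1 / 2 : ℝ)) * (1 / Real.sqrt Real.pi) := by
    rw [Real.mul_rpow (by norm_num) Real.pi_pos.le, Real.rpow_neg Real.pi_pos.le,
      Real.sqrt_eq_rpow]; ring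
  rw [e3, Real.rpow_add hB, smul_eq_mul]
  linear_combination (2 ^ (-(1 / 2 : ℝ)) * (1 / Real.sqrt Real.pi) * B ^ q *
    ∫ t in Set.Ioi (0 : ℝ), (Real.exp (-(B / (2 * A)) * t) * t ^ ((1 / 2 : ℝ) - 1) *
        (1 + t) ^ (q + 3 / 2 - 1 / 2 - 1))) * e2

theorem integral_gaussianReal_pow_even (m : ℕ) :
    ∫ e, (e ^ 2) ^ m ∂(gaussianReal 0 1) = 2 ^ m * Real.Gamma (m + 1 / 2) / Real.sqrt Real.pi := by
  rw [integral_gaussianReal_comp_sq (fun t => t ^ m)]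
  have h3 : ∀ t ∈ Set.Ioi (0 : ℝ), Real.exp (-t / 2) * t ^ (-(1 / 2 : ℝ)) * t ^ m =
      t ^ (((m : ℝ) + 1 / 2) - 1) * Real.exp (-((1 / 2) * t)) := by
    intro t (ht : 0 < t)
    rw [show (((m : ℝ) + 1 / 2) - 1) = -(1 / 2) + m by ring, Real.rpow_add ht, Real.rpow_natCast,
      show -t / 2 = -((1 / 2) * t) by ring]
    ring
  rw [setIntegral_congr_fun measurableSet_Ioi h3,
    Real.integral_rpow_mul_exp_neg_mul_Ioi (by positivity) (by norm_num)]
  rw [Real.mul_rpow (by norm_num) Real.pi_pos.le, Real.rpow_neg Real.pi_pos.le,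
      ← Real.sqrt_eq_rpow, show (1 / (1 / 2) : ℝ) = 2 by norm_num, Real.rpow_add (by norm_num),
      Real.rpow_natCast, Real.rpow_neg (by norm_num)]
  field_simp

/-- Here the exponent of `1 + t` is the natural number `n`: expanding it gives finitely many Gamma
integrals. -/
theorem tricomi_half_add_nat (n : ℕ) {ξ : ℝ} (hξ : 0 < ξ) :
    tricomi (1 / 2) (3 / 2 + n) ξ =
      Real.Gamma (n + 1 / 2) / Real.sqrt Real.pi * ξ ^ (-(1 / 2 : ℝ) - n) *
        ∑ i ∈ Finset.range (n + 1),
          (n.choose i : ℝ) / Ring.choose (-(1 / 2 : ℝ) + n) i * (ξ ^ i / i.factorial) := by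
  have hpt : ∀ t ∈ Set.Ioi (0 : ℝ),
      Real.exp (-ξ * t) * t ^ ((1 / 2 : ℝ) - 1) * (1 + t) ^ (3 / 2 + (n : ℝ) - 1 / 2 - 1) =
      ∑ i ∈ Finset.range (n + 1), (n.choose i : ℝ) *
        (t ^ ((n - i : ℕ) + 1 / 2 - 1 : ℝ) * Real.exp (-(ξ * t))) := by
    intro t (ht : 0 < t)
    rw [show 3 / 2 + (n : ℝ) - 1 / 2 - 1 = n by ring, Real.rpow_natCast, add_pow, Finset.mul_sum]
    refine Finset.sum_congr rfl fun i _ => ?_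
    rw [add_sub_assoc, Real.rpow_add ht, Real.rpow_natCast, one_pow, neg_mul]
    ring
  have hint : ∀ i ∈ Finset.range (n + 1), Integrable (fun t : ℝ => (n.choose i : ℝ) *
        (t ^ ((n - i : ℕ) + 1 / 2 - 1 : ℝ) * Real.exp (-(ξ * t))))
        (volume.restrict (Set.Ioi 0)) := by
    intro i _
    refine Integrable.const_mul ?_ _
    have := integrableOn_rpow_mul_exp_neg_mul_rpow (p := 1) (s := ((n - i : ℕ) + 1 / 2 - 1 : ℝ))
      (b := ξ) (by have := (n - i).cast_nonneg (α := ℝ); linarith) one_pos hξ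
    simpa [IntegrableOn] using this
  rw [tricomi, setIntegral_congr_fun measurableSet_Ioi hpt, integral_finsetSum _ hint,
    Finset.mul_sum, Finset.mul_sum]
  refine Finset.sum_congr rfl fun i hi => ?_
  have hin : i ≤ n := Nat.lt_succ_iff.1 (Finset.mem_range.1 hi)
  have hin' : (i : ℝ) ≤ n := by exact_mod_cast hin
  rw [integral_const_mul, Real.integral_rpow_mul_exp_neg_mul_Ioi (by positivity) hξ,
    Real.Gamma_one_half_eq]
  -- This trades `Γ(n - i + 1/2)` for `Γ(n + 1/2)` divided by `i!` and a binomial coefficient.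
  have hg := choose_mul_factorial_mul_Gamma (r := -(1 / 2 : ℝ) + n) i (by linarith)
  rw [show -(1 / 2 : ℝ) + n + 1 - i = (n - i : ℕ) + 1 / 2 by rw [Nat.cast_sub hin]; ring,
    show -(1 / 2 : ℝ) + n + 1 = n + 1 / 2 by ring] at hg
  have hc : Ring.choose (-(1 / 2 : ℝ) + n) i ≠ 0 := by
    intro h0
    rw [h0, zero_mul, zero_mul] at hg
    exact (Real.Gamma_pos_of_pos (by positivity : (0 : ℝ) < n + 1 / 2)).ne hg
  rw [← hg, one_div ξ, Real.inv_rpow hξ.le, ← Real.rpow_neg hξ.le,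
    show -((n - i : ℕ) + 1 / 2 : ℝ) = (-(1 / 2) - n) + i by rw [Nat.cast_sub hin]; ring,
    Real.rpow_add hξ, Real.rpow_natCast]
  generalize Ring.choose (-(1 / 2 : ℝ) + n) i = c at hc ⊢
  field_simp

/-! ### Power series of the Gaussian c.d.f. -/

theorem gaussianReal_real_Iic_eq_intervalIntegral (y : ℝ) :
    (gaussianReal 0 1).real (Set.Iic y) = 1 / 2 + ∫ x in (0 : ℝ)..y, gaussianPDFReal 0 1 x := by
  have hpdf : ∀ s : Set ℝ, MeasurableSet s →
      (gaussianReal 0 1).real s = ∫ x in s, gaussianPDFReal 0 1 x := by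
    intro s hs
    rw [measureReal_def, gaussianReal_apply_eq_integral 0 one_ne_zero,
      ENNReal.toReal_ofReal (setIntegral_nonneg hs fun x _ => gaussianPDFReal_nonneg _ _ _)]
  have hint := integrable_gaussianPDFReal 0 1
  have hhalf : (gaussianReal 0 1).real (Set.Iic 0) = 1 / 2 := by
    have h1 : (gaussianReal 0 1).real (Set.Iic 0) = (gaussianReal 0 1).real (Set.Ioi 0) := by
      rw [hpdf _ measurableSet_Iic, hpdf _ measurableSet_Ioi, ← neg_zero,
        ← integral_comp_neg_Iic, neg_zero]
      simp [gaussianPDFReal]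
    have h2 := probReal_add_probReal_compl (μ := gaussianReal 0 1) (s := Set.Iic (0 : ℝ))
      measurableSet_Iic
    rw [Set.compl_Iic, ← h1] at h2
    linarith
  rw [← hhalf, hpdf _ measurableSet_Iic, hpdf _ measurableSet_Iic,
    ← intervalIntegral.integral_Iic_sub_Iic hint.integrableOn hint.integrableOn]
  ring

/-- The exponential series of the density is integrated termwise between `0` and `y`, dominated by
the series of `exp (y² / 2)`. -/
theorem hasSum_gaussianReal_real_Iic (y : ℝ) :
    HasSum (fun j : ℕ => (2 * Real.pi) ^ (-(1 / 2 : ℝ)) *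
        ((-2 : ℝ) ^ (-(j : ℤ)) / (j.factorial * (2 * (j : ℝ) + 1)) * y ^ (2 * j + 1)))
      ((gaussianReal 0 1).real (Set.Iic y) - 1 / 2) := by
  rw [gaussianReal_real_Iic_eq_intervalIntegral, add_sub_cancel_left]
  have hterm : ∀ (j : ℕ) (x : ℝ), (2 * Real.pi) ^ (-(1 / 2 : ℝ)) *
      ((-(x ^ 2) / 2) ^ j / j.factorial) = (2 * Real.pi) ^ (-(1 / 2 : ℝ)) *
        ((-2 : ℝ) ^ (-(j : ℤ)) / j.factorial) * x ^ (2 * j) := by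
    intro j x
    rw [zpow_neg, zpow_natCast, ← inv_pow, pow_mul,
      show -(x ^ 2) / 2 = (-2)⁻¹ * x ^ 2 by ring, mul_pow]
    ring
  have h := intervalIntegral.hasSum_integral_of_dominated_convergence (μ := volume) (a := 0)
    (b := y) (F := fun (j : ℕ) (x : ℝ) => (2 * Real.pi) ^ (-(1 / 2 : ℝ)) *
      ((-(x ^ 2) / 2) ^ j / j.factorial)) (f := gaussianPDFReal 0 1)
    (fun j _ => (2 * Real.pi) ^ (-(1 / 2 : ℝ)) * ((y ^ 2 / 2) ^ j / j.factorial))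
    (fun j => by fun_prop) (fun j => .of_forall fun x hx => ?_)
    (.of_forall fun _ _ => (Real.summable_pow_div_factorial _).mul_left _)
    intervalIntegrable_const (.of_forall fun x _ => ?_)
  · convert! h using 2 with j
    simp_rw [hterm]
    rw [intervalIntegral.integral_const_mul, integral_pow]
    push_cast
    rw [zero_pow (by omega)]
    field_simp
    ring
  · rw [norm_mul, norm_div, norm_pow, Real.norm_of_nonneg (by positivity : (0 : ℝ) ≤
      (2 * Real.pi) ^ (-(1 / 2 : ℝ))), Real.norm_natCast, norm_div, norm_neg,
      Real.norm_of_nonneg (sq_nonneg x), Real.norm_two]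
    have : x ^ 2 ≤ y ^ 2 := by
      rw [sq_le_sq]
      rcases Set.mem_uIoc.1 hx with ⟨h1, h2⟩ | ⟨h1, h2⟩
      · rw [abs_of_pos h1, abs_of_pos (h1.trans_le h2)]; exact h2
      · rw [abs_of_nonpos h2, abs_of_neg (h1.trans_le h2)]; linarith
    gcongr
  · have := (NormedSpace.expSeries_div_hasSum_exp (-(x ^ 2) / 2)).mul_left ((2 * Real.pi) ^ (-(1 / 2 : ℝ)))
    rw [← congrFun Real.exp_eq_exp_ℝ] at this
    convert! this using 1
    simp only [gaussianPDFReal, NNReal.coe_one, sub_zero, mul_one]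
    rw [Real.sqrt_eq_rpow, ← Real.rpow_neg (by positivity)]

/-! ### The variance recursion as a Markov kernel, and its lower bound. -/

/-- One step of the conditional variance recursion: from `σ_t²` and `ε_t` to `σ_{t+1}²`. -/
def varianceStep (ω β : ℝ) (f : ℝ → ℝ) (p : ℝ × ℝ) : ℝ := ω + (f p.2 * p.2 ^ 2 + β) * p.1

theorem measurable_varianceStep (ω β : ℝ) {f : ℝ → ℝ} (hf : Measurable f) :
    Measurable (varianceStep ω β f) := by
  unfold varianceStep
  fun_prop

/-- The law of `σ_{n+1}²` given `σ_1²`, where the ARCH coefficient at time `t` is the function `a t`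
of the innovation at time `t`. -/
noncomputable def varianceKernel (ω β : ℝ) (a : ℕ → ℝ → ℝ) : ℕ → Kernel ℝ ℝ
  | 0 => Kernel.id
  | n + 1 => ((varianceKernel ω β a n) ×ₖ Kernel.const ℝ (gaussianReal 0 1)).map
      (varianceStep ω β (a (n + 1)))

theorem isMarkovKernel_varianceKernel (ω β : ℝ) {a : ℕ → ℝ → ℝ} (ha : ∀ n, Measurable (a n)) :
    ∀ n, IsMarkovKernel (varianceKernel ω β a n)
  | 0 => by unfold varianceKernel; infer_instance
  | n + 1 => by
    have := isMarkovKernel_varianceKernel ω β ha n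
    unfold varianceKernel
    exact Kernel.IsMarkovKernel.map _ (measurable_varianceStep ω β (ha _))

theorem varianceKernel_zero_apply (ω β : ℝ) (a : ℕ → ℝ → ℝ) (v : ℝ) :
    varianceKernel ω β a 0 v = Measure.dirac v := by
  simp [varianceKernel, Kernel.id_apply]

theorem varianceKernel_succ_apply (ω β : ℝ) {a : ℕ → ℝ → ℝ} (ha : ∀ n, Measurable (a n)) (n : ℕ)
    (v : ℝ) : varianceKernel ω β a (n + 1) v =
      ((varianceKernel ω β a n v).prod (gaussianReal 0 1)).map (varianceStep ω β (a (n + 1))) := by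
  have := isMarkovKernel_varianceKernel ω β ha n
  rw [varianceKernel, Kernel.map_apply _ (measurable_varianceStep ω β (ha _)), Kernel.prod_apply,
    Kernel.const_apply]

/-- The lower bound of `σ_{n+1}²` obtained from vanishing innovations. -/
def varianceLower (ω β v : ℝ) : ℕ → ℝ
  | 0 => v
  | n + 1 => ω + β * varianceLower ω β v n

theorem varianceLower_pos {ω β v : ℝ} (hω : 0 < ω) (hβ : 0 < β) (hv : 0 < v) :
    ∀ n, 0 < varianceLower ω β v n
  | 0 => hv
  | n + 1 => by have := varianceLower_pos hω hβ hv n; unfold varianceLower; positivity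

theorem ae_varianceLower_le {ω β v : ℝ} {a : ℕ → ℝ → ℝ} (hω : 0 < ω) (hβ : 0 < β) (hv : 0 < v)
    (ha : ∀ n, Measurable (a n)) (ha0 : ∀ n e, 0 ≤ a n e) :
    ∀ n, ∀ᵐ u ∂(varianceKernel ω β a n v), varianceLower ω β v n ≤ u
  | 0 => by
    rw [varianceKernel_zero_apply, ae_dirac_iff measurableSet_Ici]
    exact le_rfl
  | n + 1 => by
    have := isMarkovKernel_varianceKernel ω β ha n
    rw [varianceKernel_succ_apply ω β ha,
      ae_map_iff (measurable_varianceStep ω β (ha _)).aemeasurable measurableSet_Ici]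
    have h := Measure.quasiMeasurePreserving_fst (μ := varianceKernel ω β a n v)
      (ν := gaussianReal 0 1) |>.ae (ae_varianceLower_le hω hβ hv ha ha0 n)
    filter_upwards [h] with p hp
    have h0 := varianceLower_pos hω hβ hv n
    have h1 : 0 ≤ a (n + 1) p.2 * p.2 ^ 2 := mul_nonneg (ha0 _ _) (sq_nonneg _)
    have h2 := mul_nonneg h1 (h0.le.trans hp)
    have h3 := mul_le_mul_of_nonneg_left hp hβ.le
    simp only [varianceStep, varianceLower]
    linarith

/-- Writing `L_t` for the lower bound, `β L_{t+1} = βω + β (β L_t) > 2βω ≥ ω`; this is where `1/2`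
comes from. -/
theorem lt_mul_varianceLower {ω β v : ℝ} (hω : 0 < ω) (hβ : 0 < β) {n : ℕ}
    (h1 : 1 ≤ n → ω < β * (ω + β * v)) (h2 : 2 ≤ n → 1 / 2 ≤ β) :
    ∀ t, 1 ≤ t → t ≤ n → ω < β * varianceLower ω β v t := by
  intro t ht
  induction t, ht using Nat.le_induction with
  | base => exact fun hn => h1 hn
  | succ t ht ih =>
    intro hn
    have hb := h2 (by omega)
    have := mul_lt_mul_of_pos_left (ih (by omega)) hβ
    rw [varianceLower, mul_add]
    nlinarith

theorem integrable_gaussianReal_add_mul_sq_pow (β a : ℝ) (m : ℕ) :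
    Integrable (fun e : ℝ => (a * e ^ 2 + β) ^ m) (gaussianReal 0 1) := by
  have h : ∀ i : ℕ, Integrable (fun e : ℝ => e ^ (2 * i)) (gaussianReal 0 1) := fun i =>
    (integrable_norm_iff (by fun_prop)).1 (by
      simpa using (memLp_id_gaussianReal (μ := 0) (v := 1) (2 * i : ℕ)).integrable_norm_pow')
  simp_rw [add_pow]
  refine integrable_finsetSum _ fun i _ => ?_
  refine ((h i).mul_const (a ^ i * β ^ (m - i) * (m.choose i : ℝ))).congr (.of_forall fun e => ?_)
  simp only [mul_pow, ← pow_mul]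
  ring

/-! ### Constant ARCH coefficients: one step of the moment recursion. -/

/-- The law of `σ_{n+1}²` given `σ_1² = v` if the ARCH coefficients are the constants `a t`. -/
noncomputable def varianceLaw (ω β v : ℝ) (a : ℕ → ℝ) (n : ℕ) : Measure ℝ :=
  varianceKernel ω β (fun t _ => a t) n v

instance (ω β v : ℝ) (a : ℕ → ℝ) (n : ℕ) : IsProbabilityMeasure (varianceLaw ω β v a n) := by
  have := isMarkovKernel_varianceKernel ω β (a := fun t _ => a t) (fun _ => measurable_const) n
  unfold varianceLaw
  infer_instance

theorem varianceLaw_zero (ω β v : ℝ) (a : ℕ → ℝ) : varianceLaw ω β v a 0 = Measure.dirac v :=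
  varianceKernel_zero_apply _ _ _ _

theorem varianceLaw_succ (ω β v : ℝ) (a : ℕ → ℝ) (n : ℕ) : varianceLaw ω β v a (n + 1) =
    ((varianceLaw ω β v a n).prod (gaussianReal 0 1)).map
      (varianceStep ω β fun _ => a (n + 1)) :=
  varianceKernel_succ_apply ω β (fun _ => measurable_const) n v

theorem integral_varianceLaw_succ (ω β v : ℝ) (a : ℕ → ℝ) (n : ℕ) {g : ℝ → ℝ} (hg : Measurable g) :
    ∫ u, g u ∂(varianceLaw ω β v a (n + 1)) =
      ∫ p, g (ω + (a (n + 1) * p.2 ^ 2 + β) * p.1)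
        ∂((varianceLaw ω β v a n).prod (gaussianReal 0 1)) := by
  rw [varianceLaw_succ, integral_map (measurable_varianceStep ω β measurable_const).aemeasurable
    hg.aestronglyMeasurable]
  rfl

theorem integrable_pow_varianceLaw (ω β v : ℝ) (a : ℕ → ℝ) (n m : ℕ) :
    Integrable (fun u => u ^ m) (varianceLaw ω β v a n) := by
  induction n generalizing m with
  | zero => rw [varianceLaw_zero]; exact integrable_dirac (by simp)
  | succ n ih =>
    rw [varianceLaw_succ, integrable_map_measure (by fun_prop)
      (measurable_varianceStep ω β measurable_const).aemeasurable]
    simp only [varianceStep, Function.comp_def, add_pow ω]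
    refine integrable_finsetSum _ fun i _ => ?_
    refine (((ih (m - i)).mul_prod (integrable_gaussianReal_add_mul_sq_pow β (a (n + 1))
      (m - i))).const_mul (ω ^ i * (m.choose i : ℝ))).congr (.of_forall fun p => ?_)
    simp only [mul_pow]
    ring

theorem ae_varianceLower_le_varianceLaw {ω β v : ℝ} {a : ℕ → ℝ} (hω : 0 < ω) (hβ : 0 < β)
    (hv : 0 < v) (ha : ∀ n, 0 ≤ a n) (n : ℕ) :
    ∀ᵐ u ∂(varianceLaw ω β v a n), varianceLower ω β v n ≤ u :=
  ae_varianceLower_le hω hβ hv (fun _ => measurable_const) (fun n _ => ha n) n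

theorem upperLimit_natCast (m : ℕ) : upperLimit m = m := by
  simp [upperLimit]

theorem upperLimit_of_neg {q : ℝ} (hq : q < 0) : upperLimit q = ⊤ := by
  rw [upperLimit, if_neg]
  rintro ⟨n, rfl⟩
  exact absurd hq (not_lt.2 n.cast_nonneg)

theorem integral_varianceLaw_succ_pow (ω β v : ℝ) (a : ℕ → ℝ) (n m : ℕ) :
    ∫ u, u ^ m ∂(varianceLaw ω β v a (n + 1)) = ∑ k ∈ Finset.range (m + 1),
      (m.choose k : ℝ) * ω ^ k * (∫ e, (β + a (n + 1) * e ^ 2) ^ (m - k) ∂(gaussianReal 0 1)) *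
        ∫ u, u ^ (m - k) ∂(varianceLaw ω β v a n) := by
  rw [integral_varianceLaw_succ _ _ _ _ _ (by fun_prop)]
  have hpt : ∀ p : ℝ × ℝ, (ω + (a (n + 1) * p.2 ^ 2 + β) * p.1) ^ m =
      ∑ k ∈ Finset.range (m + 1), ((m.choose k : ℝ) * ω ^ k) *
        (p.1 ^ (m - k) * (a (n + 1) * p.2 ^ 2 + β) ^ (m - k)) := by
    intro p
    rw [add_pow]
    refine Finset.sum_congr rfl fun k _ => ?_
    rw [mul_pow]; ring
  simp_rw [hpt]
  rw [integral_finsetSum _ fun k _ => Integrable.const_mul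
    ((integrable_pow_varianceLaw _ _ _ _ _ _).mul_prod
      (integrable_gaussianReal_add_mul_sq_pow _ _ _)) _]
  refine Finset.sum_congr rfl fun k _ => ?_
  rw [integral_const_mul, integral_prod_mul (fun u : ℝ => u ^ (m - k))
    (fun e : ℝ => (a (n + 1) * e ^ 2 + β) ^ (m - k))]
  simp_rw [add_comm β]
  ring

/-- Almost surely `(a ε² + β) σ² ≥ L > ω`, so the binomial series converges with a uniform ratio `ω
/ L < 1`. This permits termwise integration, and independence splits each term. -/
theorem hasSum_integral_varianceLaw_succ_rpow {ω β v : ℝ} {a : ℕ → ℝ} (hω : 0 < ω) (hβ : 0 < β)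
    (hv : 0 < v) (ha : ∀ n, 0 ≤ a n) {n : ℕ} {q : ℝ} (hq : q < 0)
    (hn : ω < β * varianceLower ω β v n) :
    HasSum (fun k : ℕ => Ring.choose q k * ω ^ k *
        (∫ e, (β + a (n + 1) * e ^ 2) ^ (q - k) ∂(gaussianReal 0 1)) *
        ∫ u, u ^ (q - k) ∂(varianceLaw ω β v a n))
      (∫ u, u ^ q ∂(varianceLaw ω β v a (n + 1))) := by
  set L := β * varianceLower ω β v n with hL
  have hL0 : 0 < L := hω.trans hn
  rw [integral_varianceLaw_succ _ _ _ _ _ (by fun_prop)]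
  set P := (varianceLaw ω β v a n).prod (gaussianReal 0 1)
  have hlow : ∀ᵐ p ∂P, 0 ≤ p.1 ∧ L ≤ (a (n + 1) * p.2 ^ 2 + β) * p.1 := by
    have h := Measure.quasiMeasurePreserving_fst (μ := varianceLaw ω β v a n)
      (ν := gaussianReal 0 1) |>.ae (ae_varianceLower_le_varianceLaw hω hβ hv ha n)
    filter_upwards [h] with p hp
    have h0 := varianceLower_pos hω hβ hv n
    have h1 : 0 ≤ a (n + 1) * p.2 ^ 2 := mul_nonneg (ha _) (sq_nonneg _)
    have h2 := mul_nonneg h1 (h0.le.trans hp)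
    have h3 := mul_le_mul_of_nonneg_left hp hβ.le
    exact ⟨h0.le.trans hp, by linarith⟩
  let F : ℕ → ℝ × ℝ → ℝ := fun k p => Ring.choose q k * ω ^ k *
    ((a (n + 1) * p.2 ^ 2 + β) * p.1) ^ (q - k)
  -- The exponent `q - k` is negative, so the power is largest at the lower bound `L`.
  have hbound : ∀ k, ∀ᵐ p ∂P, ‖F k p‖ ≤ |Ring.choose q k| * (ω / L) ^ k * L ^ q := by
    intro k
    filter_upwards [hlow] with p hp
    have h1 : ((a (n + 1) * p.2 ^ 2 + β) * p.1) ^ (q - k) ≤ L ^ (q - k) :=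
      Real.rpow_le_rpow_of_nonpos hL0 hp.2 (by have := k.cast_nonneg (α := ℝ); linarith)
    have h2 : 0 ≤ ((a (n + 1) * p.2 ^ 2 + β) * p.1) ^ (q - k) :=
      Real.rpow_nonneg (hL0.le.trans hp.2) _
    rw [norm_mul, norm_mul, Real.norm_eq_abs, norm_pow, Real.norm_of_nonneg hω.le,
      Real.norm_of_nonneg h2]
    calc _ ≤ |Ring.choose q k| * ω ^ k * L ^ (q - k) := by gcongr
      _ = _ := by rw [Real.rpow_sub_natCast hL0.ne', div_pow]; field_simp
  have hmeas : ∀ k, AEStronglyMeasurable (F k) P := fun k => by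
    simp only [F]; exact Measurable.aestronglyMeasurable (by fun_prop)
  have hint : ∀ k, Integrable (F k) P := fun k =>
    Integrable.of_bound (hmeas k) _ (hbound k)
  have hsum : Summable fun k => ∫ p, ‖F k p‖ ∂P := by
    refine Summable.of_nonneg_of_le (fun k => integral_nonneg fun _ => norm_nonneg _) (fun k => ?_)
      ((summable_abs_choose_mul_pow q (r := ω / L) (by positivity)
        ((div_lt_one hL0).2 hn)).mul_right (L ^ q))
    refine (integral_mono_ae (hint k).norm (integrable_const _) (hbound k)).trans ?_
    simp
  have h := hasSum_integral_of_summable_integral_norm hint hsum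
  convert! h using 1
  · funext k
    simp only [F]
    rw [integral_const_mul]
    have : ∫ p, ((a (n + 1) * p.2 ^ 2 + β) * p.1) ^ (q - k) ∂P =
        ∫ p, p.1 ^ (q - k) * (a (n + 1) * p.2 ^ 2 + β) ^ (q - k) ∂P := by
      refine integral_congr_ae ?_
      filter_upwards [hlow] with p hp
      have := ha (n + 1)
      rw [Real.mul_rpow (by positivity) hp.1, mul_comm]
    rw [this, integral_prod_mul (fun u : ℝ => u ^ (q - k))
      (fun e : ℝ => (a (n + 1) * e ^ 2 + β) ^ (q - k))]
    simp_rw [add_comm β]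
    ring
  · refine integral_congr_ae ?_
    filter_upwards [hlow] with p hp
    exact (hasSum_add_rpow q hω.le (hn.trans_le hp.2)).tsum_eq.symm

theorem hasSum_integral_varianceLaw_succ {ω β v : ℝ} {a : ℕ → ℝ} (hω : 0 < ω) (hβ : 0 < β)
    (hv : 0 < v) (ha : ∀ n, 0 ≤ a n) {n : ℕ} {q : ℝ}
    (hq : (∃ m : ℕ, q = m) ∨ q < 0 ∧ ω < β * varianceLower ω β v n) :
    HasSum (fun k : ℕ => if (k : ℕ∞) ≤ upperLimit q then Ring.choose q k * ω ^ k *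
        (∫ e, (β + a (n + 1) * e ^ 2) ^ (q - k) ∂(gaussianReal 0 1)) *
        ∫ u, u ^ (q - k) ∂(varianceLaw ω β v a n) else 0)
      (∫ u, u ^ q ∂(varianceLaw ω β v a (n + 1))) := by
  rcases hq with ⟨m, rfl⟩ | ⟨hq, hn⟩
  · simp_rw [upperLimit_natCast, Nat.cast_le, Real.rpow_natCast]
    rw [integral_varianceLaw_succ_pow]
    have h := hasSum_sum_of_ne_finset_zero (L := .unconditional ℕ) (s := Finset.range (m + 1))
      (f := fun k : ℕ => if k ≤ m then Ring.choose (m : ℝ) k * ω ^ k *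
        (∫ e, (β + a (n + 1) * e ^ 2) ^ ((m : ℝ) - k) ∂(gaussianReal 0 1)) *
        ∫ u, u ^ ((m : ℝ) - k) ∂(varianceLaw ω β v a n) else 0) (fun k hk =>
          if_neg (by simpa [Nat.lt_succ_iff] using hk))
    convert! h using 1
    refine Finset.sum_congr rfl fun k hk => ?_
    have hkm : k ≤ m := Nat.lt_succ_iff.1 (Finset.mem_range.1 hk)
    simp_rw [if_pos hkm, ← Nat.cast_sub hkm, Real.rpow_natCast, Ring.choose_natCast]
  · simp only [upperLimit_of_neg hq, le_top, if_true]
    exact hasSum_integral_varianceLaw_succ_rpow hω hβ hv ha hq hn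

/-! ### Iterating the recursion: nested sums. -/

theorem iterSum_const_mul (c : ℝ) (n : ℕ) (M : ℕ∞) (f : (Fin n → ℕ) → ℝ) :
    iterSum n M (fun k => c * f k) = c * iterSum n M f := by
  induction n generalizing M with
  | zero => rfl
  | succ n ih => simp only [iterSum, ih, ← tsum_mul_left, mul_ite, mul_zero]

theorem IterSummable.const_mul (c : ℝ) {n : ℕ} {M : ℕ∞} {f : (Fin n → ℕ) → ℝ}
    (h : IterSummable n M f) : IterSummable n M (fun k => c * f k) := by
  induction n generalizing M with
  | zero => trivial
  | succ n ih =>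
    refine ⟨fun k hk => ih (h.1 k hk), ?_⟩
    simpa only [iterSum_const_mul, mul_ite, mul_zero] using h.2.mul_left c

/-- The summands in the expansion of the moment `E (σ_{n+2}²)^q`. -/
noncomputable def momentTerm (ω β v : ℝ) (a : ℕ → ℝ) : (n : ℕ) → ℝ → (Fin n → ℕ) → ℝ
  | 0, q, _ => ∫ u, u ^ q ∂(varianceLaw ω β v a 1)
  | n + 1, q, k => Ring.choose q (k 0) * ω ^ k 0 *
      (∫ e, (β + a (n + 2) * e ^ 2) ^ (q - k 0) ∂(gaussianReal 0 1)) *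
      momentTerm ω β v a n (q - k 0) (Fin.tail k)

/-- The outermost index belongs to the latest time step. Fixing it leaves the same problem with one
step fewer and exponent `q - k`. -/
theorem iterSum_momentTerm {ω β v : ℝ} {a : ℕ → ℝ} (hω : 0 < ω) (hβ : 0 < β)
    (hv : 0 < v) (ha : ∀ n, 0 ≤ a n) (n : ℕ) (q : ℝ)
    (hq : (∃ m : ℕ, q = m) ∨
      q < 0 ∧ ∀ t, 1 ≤ t → t ≤ n → ω < β * varianceLower ω β v t) :
    IterSummable n (upperLimit q) (momentTerm ω β v a n q) ∧
      iterSum n (upperLimit q) (momentTerm ω β v a n q) =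
        ∫ u, u ^ q ∂(varianceLaw ω β v a (n + 1)) := by
  induction n generalizing q with
  | zero => exact ⟨trivial, rfl⟩
  | succ n ih =>
    -- The remaining summation limit is again `upperLimit (q - k)`: either `m - k`, or still `∞`.
    have key : ∀ k : ℕ, (k : ℕ∞) ≤ upperLimit q →
        IterSummable n (upperLimit q - k) (momentTerm ω β v a n (q - k)) ∧
        iterSum n (upperLimit q - k) (momentTerm ω β v a n (q - k)) =
          ∫ u, u ^ (q - k) ∂(varianceLaw ω β v a (n + 1)) := by
      intro k hk
      rcases hq with ⟨m, rfl⟩ | ⟨hq, hn⟩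
      · rw [upperLimit_natCast] at hk ⊢
        have hkm : k ≤ m := by exact_mod_cast hk
        rw [← ENat.natCast_sub, ← Nat.cast_sub hkm, ← upperLimit_natCast]
        exact ih _ (.inl ⟨_, rfl⟩)
      · have hqk : q - k < 0 := by have := k.cast_nonneg (α := ℝ); linarith
        rw [upperLimit_of_neg hq, ENat.top_sub_natCast, ← upperLimit_of_neg hqk]
        exact ih _ (.inr ⟨hqk, fun t h1 h2 => hn t h1 (by omega)⟩)
    have hs := hasSum_integral_varianceLaw_succ hω hβ hv ha (n := n + 1) (q := q)
      (hq.imp_right fun h => ⟨h.1, h.2 _ (by omega) le_rfl⟩)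
    have hcons : ∀ k : ℕ, (fun k' : Fin n → ℕ => momentTerm ω β v a (n + 1) q (Fin.cons k k')) =
        fun k' => Ring.choose q k * ω ^ k *
          (∫ e, (β + a (n + 2) * e ^ 2) ^ (q - k) ∂(gaussianReal 0 1)) *
          momentTerm ω β v a n (q - k) k' := by
      intro k; funext k'; simp [momentTerm]
    have hfun : (fun k : ℕ => if (k : ℕ∞) ≤ upperLimit q then
        iterSum n (upperLimit q - k) (fun k' => momentTerm ω β v a (n + 1) q (Fin.cons k k'))
        else 0) = fun k : ℕ => if (k : ℕ∞) ≤ upperLimit q then Ring.choose q k * ω ^ k *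
        (∫ e, (β + a (n + 2) * e ^ 2) ^ (q - k) ∂(gaussianReal 0 1)) *
        ∫ u, u ^ (q - k) ∂(varianceLaw ω β v a (n + 1)) else 0 := by
      funext k
      split_ifs with hk
      · rw [hcons, iterSum_const_mul, (key k hk).2]
      · rfl
    rw [IterSummable, iterSum, hfun]
    exact ⟨⟨fun k hk => by rw [hcons]; exact (key k hk).1.const_mul _, hs.summable⟩, hs.tsum_eq⟩

/-! ### Matching the moment expansion with the coefficients `c_{j,s}`. -/

theorem partialK_zero {n : ℕ} (k : Fin n → ℕ) : partialK k 0 = 0 := by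
  simp [partialK]

theorem partialK_cons_succ {n : ℕ} (k : ℕ) (k' : Fin n → ℕ) (t : ℕ) :
    partialK (Fin.cons k k' : Fin (n + 1) → ℕ) (t + 1) = k + partialK k' t := by
  simp [partialK, Fin.sum_univ_succ]

theorem partialS_cons_succ {n : ℕ} (k : ℕ) (k' : Fin n → ℕ) (t : ℕ) :
    partialS (Fin.cons k k' : Fin (n + 1) → ℕ) (t + 1) = partialK k' t + partialS k' t := by
  simp only [partialS, partialK, Fin.sum_univ_succ, Fin.val_zero, Fin.val_succ, Fin.cons_succ,
    ← Finset.sum_add_distrib, zero_mul, ite_self, zero_add, Nat.add_lt_add_iff_right]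
  refine Finset.sum_congr rfl fun i _ => ?_
  split_ifs <;> ring

theorem coefTerm_add_two (ω β v : ℝ) (n : ℕ) (a : ℕ → ℝ) (j : ℝ) (k : Fin n → ℕ) :
    coefTerm ω β v (n + 2) a j k =
      tricomi (1 / 2) (1 - j - partialK k n) ((ω + β * v) / (2 * a 1 * v)) *
      ω ^ partialK k n *
      β ^ ((partialS k n : ℝ) - (partialK k n + j) * n) *
      (ω + β * v) ^ (-(partialK k n : ℝ)) *
      ∏ i : Fin n,
        (Ring.choose (-(1 / 2 : ℝ) - j - partialK k i) (k i) * a (i + 1) ^ (-(1 / 2 : ℝ)) *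
          tricomi (1 / 2) (1 - j - partialK k (i + 1)) (β / (2 * a (n + 1 - i)))) := by
  have h1 : ((n + 2 : ℕ) : ℝ) - 2 = n := by push_cast; ring
  unfold coefTerm
  rw [h1]
  have h2 : ∀ i : ℕ, n + 2 - (i + 1) = n + 1 - i := by omega
  simp_rw [h2]
  rfl

/-- Removing the first index `k` lowers the horizon by one and replaces `j` by `j + k`. What splits
off is, up to a power of 2, the Gaussian integral of the last time step. -/
theorem coefFactor_mul_coefTerm_cons {ω β v : ℝ} (hω : 0 < ω) (hβ : 0 < β) (hv : 0 < v) {n : ℕ}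
    {a : ℕ → ℝ} (ha : ∀ t ∈ Finset.Icc 1 (n + 2), 0 < a t) (j : ℝ) (k : ℕ) (k' : Fin n → ℕ) :
    coefFactor ω β v (n + 1 + 2) a j *
        coefTerm ω β v (n + 1 + 2) a j (Fin.cons k k' : Fin (n + 1) → ℕ) =
      Real.pi ^ (1 / 2 : ℝ) * (Ring.choose (-(1 / 2 : ℝ) - j) k * ω ^ k *
        (a (n + 2) ^ (-(1 / 2 : ℝ)) * β ^ (-(j + k)) *
          tricomi (1 / 2) (1 - (j + k)) (β / (2 * a (n + 2))))) *
      (coefFactor ω β v (n + 2) a (j + k) * coefTerm ω β v (n + 2) a (j + k) k') := by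
  have hB : 0 < ω + β * v := by positivity
  have ha1 : 0 ≤ a (n + 1) := (ha _ (by simp)).le
  have ha2 : 0 ≤ a (n + 2) := (ha _ (by simp)).le
  rw [coefTerm_add_two, coefTerm_add_two, Fin.prod_univ_succ]
  simp only [Fin.val_zero, Fin.val_succ, Fin.cons_zero, Fin.cons_succ, partialK_cons_succ,
    partialS_cons_succ, partialK_zero, Nat.add_sub_add_right, Nat.sub_zero, zero_add,
    Nat.cast_zero, sub_zero, add_zero, Finset.prod_mul_distrib, Nat.cast_add, ← sub_sub]
  -- `coefFactor` carries the last `α`, and that index moves with the horizon; both sides are the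
  -- product over `t = 1, …, n + 1`.
  have hprod : a 1 ^ (-(1 / 2 : ℝ)) * ∏ i : Fin n, a (i + 1 + 1) ^ (-(1 / 2 : ℝ)) =
      a (n + 1) ^ (-(1 / 2 : ℝ)) * ∏ i : Fin n, a (i + 1) ^ (-(1 / 2 : ℝ)) := by
    rw [Fin.prod_univ_eq_prod_range (fun i => a (i + 1 + 1) ^ (-(1 / 2 : ℝ))) n,
      Fin.prod_univ_eq_prod_range (fun i => a (i + 1) ^ (-(1 / 2 : ℝ))) n, mul_comm,
      ← Finset.prod_range_succ' (fun i => a (i + 1) ^ (-(1 / 2 : ℝ))), Finset.prod_range_succ,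
      mul_comm]
  have hF1 : coefFactor ω β v (n + 1 + 2) a j = Real.pi ^ (1 / 2 : ℝ) *
      (Real.pi ^ (((n : ℝ) + 1) / 2) * v ^ (-(1 / 2 : ℝ)) * a (n + 2) ^ (-(1 / 2 : ℝ)) *
        (ω + β * v) ^ (-j)) := by
    rw [coefFactor, show n + 1 + 2 - 1 = n + 2 by omega, Real.mul_rpow hv.le ha2,
      show (((n + 1 + 2 : ℕ) : ℝ) - 1) / 2 = 1 / 2 + ((n : ℝ) + 1) / 2 by push_cast; ring,
      Real.rpow_add Real.pi_pos]
    ring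
  have hF2 : coefFactor ω β v (n + 2) a (j + k) =
      Real.pi ^ (((n : ℝ) + 1) / 2) * v ^ (-(1 / 2 : ℝ)) * a (n + 1) ^ (-(1 / 2 : ℝ)) *
        (ω + β * v) ^ (-(j + k)) := by
    rw [coefFactor, show n + 2 - 1 = n + 1 by omega, Real.mul_rpow hv.le ha1,
      show (((n + 2 : ℕ) : ℝ) - 1) / 2 = ((n : ℝ) + 1) / 2 by push_cast; ring]
    ring
  -- The weights `i - 1` in `S` drop by one with the first index removed, which adds a `K` that
  -- cancels against the extra factor in `(K + j)(h - 2)`.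
  have hβ1 : β ^ ((partialK k' n : ℝ) + partialS k' n - ((k : ℝ) + partialK k' n + j) *
      ((n : ℝ) + (1 : ℕ))) = β ^ (-(j + k)) *
        β ^ ((partialS k' n : ℝ) - (partialK k' n + (j + k)) * n) := by
    rw [← Real.rpow_add hβ]; congr 1; push_cast; ring
  have hB1 : (ω + β * v) ^ (-j) * (ω + β * v) ^ (-((k : ℝ) + partialK k' n)) =
      (ω + β * v) ^ (-(j + k)) * (ω + β * v) ^ (-(partialK k' n : ℝ)) := by
    rw [← Real.rpow_add hB, ← Real.rpow_add hB]; congr 1; ring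
  rw [hF1, hF2, hβ1, pow_add]
  -- With all powers abstracted, the goal is an identity of monomials modulo `hprod` and `hB1`.
  generalize (∏ i : Fin n, a (i + 1 + 1) ^ (-(1 / 2 : ℝ))) = P2 at hprod ⊢
  generalize (∏ i : Fin n, a (i + 1) ^ (-(1 / 2 : ℝ))) = P1 at hprod ⊢
  generalize (∏ i : Fin n, Ring.choose (-(1 / 2 : ℝ) - j - k - partialK k' i) (k' i)) = C
  generalize (∏ i : Fin n, tricomi _ _ _) = T
  generalize tricomi _ _ _ = T1
  generalize tricomi _ _ _ = T2
  generalize Real.pi ^ (1 / 2 : ℝ) = p1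
  generalize Real.pi ^ (((n : ℝ) + 1) / 2) = p2
  generalize v ^ (-(1 / 2 : ℝ)) = v2
  generalize (ω + β * v) ^ (-j) = b1 at hB1 ⊢
  generalize (ω + β * v) ^ (-((k : ℝ) + partialK k' n)) = b2 at hB1 ⊢
  generalize (ω + β * v) ^ (-(j + k)) = b3 at hB1 ⊢
  generalize (ω + β * v) ^ (-(partialK k' n : ℝ)) = b4 at hB1 ⊢
  generalize a 1 ^ (-(1 / 2 : ℝ)) = a1 at hprod ⊢
  generalize a (n + 1) ^ (-(1 / 2 : ℝ)) = a2 at hprod ⊢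
  generalize a (n + 2) ^ (-(1 / 2 : ℝ)) = a3
  generalize β ^ (-(j + k)) = c1
  generalize β ^ ((partialS k' n : ℝ) - (partialK k' n + (j + k)) * n) = c2
  generalize Ring.choose (-(1 / 2 : ℝ) - j) k = C1
  linear_combination (p1 * p2 * v2 * a3 * T1 * T2 * C * T * C1 * ω ^ k * ω ^ partialK k' n *
    c1 * c2) * (a1 * P2 * hB1 + b3 * b4 * hprod)

/-- Each of the `n + 1` Gaussian integrals, including the one over the step from the known `σ_1²`,
carries `2^(-1/2)`; this turns the power of `π` into one of `2π`. -/
theorem coefFactor_mul_coefTerm {ω β v : ℝ} (hω : 0 < ω) (hβ : 0 < β) (hv : 0 < v) (n : ℕ)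
    {a : ℕ → ℝ} (ha : ∀ t ∈ Finset.Icc 1 (n + 1), 0 < a t) (j : ℝ) (k : Fin n → ℕ) :
    coefFactor ω β v (n + 2) a j * coefTerm ω β v (n + 2) a j k =
      (2 * Real.pi) ^ (((n : ℝ) + 1) / 2) * momentTerm ω β v a n (-(1 / 2) - j) k := by
  have h2 : (2 : ℝ) ^ (1 / 2 : ℝ) * 2 ^ (-(1 / 2 : ℝ)) = 1 := by
    rw [← Real.rpow_add two_pos]; norm_num
  induction n generalizing j with
  | zero =>
    have hB : 0 < ω + β * v := by positivity
    have ha1 : 0 < a 1 := ha 1 (by simp)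
    rw [coefTerm_add_two, momentTerm, integral_varianceLaw_succ _ _ _ _ _ (by fun_prop),
      varianceLaw_zero]
    have h1 : ∫ p, (ω + (a (0 + 1) * p.2 ^ 2 + β) * p.1) ^ (-(1 / 2) - j)
        ∂((Measure.dirac v).prod (gaussianReal 0 1)) =
        ∫ e, (ω + β * v + (v * a 1) * e ^ 2) ^ (-(1 / 2) - j) ∂(gaussianReal 0 1) := by
      rw [Measure.dirac_prod, integral_map (by fun_prop)
        (Measurable.aestronglyMeasurable (by fun_prop))]
      congr 1; funext e; congr 1; ring
    rw [h1, integral_gaussianReal_add_mul_sq_rpow (by positivity) hB, coefFactor]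
    simp only [partialK_zero, Finset.univ_eq_empty, Finset.prod_empty, Nat.cast_zero, pow_zero,
      mul_zero, sub_zero, neg_zero, Real.rpow_zero, mul_one, zero_add, partialS,
      Finset.sum_empty, Real.mul_rpow two_pos.le Real.pi_pos.le]
    rw [show -(1 / 2) - j + 1 / 2 = -j by ring, show -(1 / 2) - j + 3 / 2 = 1 - j by ring,
      show (((2 : ℕ) : ℝ) - 1) / 2 = 1 / 2 by norm_num, show 2 - 1 = 1 from rfl,
      show 2 * (v * a 1) = 2 * a 1 * v by ring]
    linear_combination (-(Real.pi ^ (1 / 2 : ℝ) * (v * a 1) ^ (-(1 / 2 : ℝ)) *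
      (ω + β * v) ^ (-j) * tricomi (1 / 2) (1 - j) ((ω + β * v) / (2 * a 1 * v)))) * h2
  | succ n ih =>
    obtain ⟨k0, k', rfl⟩ : ∃ k0 k', k = Fin.cons k0 k' := ⟨k 0, Fin.tail k, (Fin.cons_self_tail k).symm⟩
    have ha2 : 0 < a (n + 2) := ha _ (by simp)
    rw [coefFactor_mul_coefTerm_cons hω hβ hv ha,
      ih (fun t ht => ha t (Finset.Icc_subset_Icc_right (by omega) ht)), momentTerm,
      integral_gaussianReal_add_mul_sq_rpow ha2 hβ, Fin.cons_zero, Fin.tail_cons,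
      show -(1 / 2) - j - k0 + 1 / 2 = -(j + k0) by ring,
      show -(1 / 2) - j - k0 + 3 / 2 = 1 - (j + k0) by ring,
      show -(1 / 2) - (j + k0) = -(1 / 2) - j - k0 by ring,
      show (((n + 1 : ℕ) : ℝ) + 1) / 2 = 1 / 2 + ((n : ℝ) + 1) / 2 by push_cast; ring,
      Real.rpow_add (by positivity : (0 : ℝ) < 2 * Real.pi),
      Real.mul_rpow (z := 1 / 2) two_pos.le Real.pi_pos.le]
    generalize momentTerm ω β v a n _ _ = T
    generalize tricomi _ _ _ = X
    linear_combination (-(Real.pi ^ (1 / 2 : ℝ) * (2 * Real.pi) ^ (((n : ℝ) + 1) / 2) *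
      Ring.choose (-(1 / 2) - j) k0 * ω ^ k0 * a (n + 2) ^ (-(1 / 2 : ℝ)) *
      β ^ (-(j + k0)) * X * T)) * h2

/-- Strict positivity is required only on the actual time range because `signAlpha` is `0` outside
it. -/
theorem iterSummable_coefTerm_and_coef_eq {ω β v : ℝ} (hω : 0 < ω) (hβ : 0 < β) (hv : 0 < v)
    (n : ℕ) {a : ℕ → ℝ} (ha0 : ∀ t, 0 ≤ a t) (ha : ∀ t ∈ Finset.Icc 1 (n + 1), 0 < a t) (j : ℝ)
    (hj : (∃ m : ℕ, -(1 / 2) - j = m) ∨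
      -(1 / 2) - j < 0 ∧ ∀ t, 1 ≤ t → t ≤ n → ω < β * varianceLower ω β v t) :
    IterSummable n (upperLimit (-(1 / 2) - j)) (coefTerm ω β v (n + 2) a j) ∧
      coef ω β v (n + 2) a j = (2 * Real.pi) ^ (((n : ℝ) + 1) / 2) *
        ∫ u, u ^ (-(1 / 2) - j) ∂(varianceLaw ω β v a (n + 1)) := by
  have hB : 0 < ω + β * v := by positivity
  have hF : 0 < coefFactor ω β v (n + 2) a j := by
    have : 0 < a (n + 1) := ha _ (by simp)
    unfold coefFactor
    simp only [show n + 2 - 1 = n + 1 by omega]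
    have := Real.pi_pos
    positivity
  have hT := coefFactor_mul_coefTerm hω hβ hv n ha j
  have hM := iterSum_momentTerm hω hβ hv ha0 n (-(1 / 2) - j) hj
  have hT' : coefTerm ω β v (n + 2) a j = fun k =>
      ((coefFactor ω β v (n + 2) a j)⁻¹ * (2 * Real.pi) ^ (((n : ℝ) + 1) / 2)) *
        momentTerm ω β v a n (-(1 / 2) - j) k := by
    funext k
    rw [mul_assoc, ← hT k, inv_mul_cancel_left₀ hF.ne']
  have hsum : iterSum (n + 2 - 2) (upperLimit (-(1 / 2) - j)) (coefTerm ω β v (n + 2) a j) =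
      iterSum n (upperLimit (-(1 / 2) - j)) (coefTerm ω β v (n + 2) a j) := rfl
  refine ⟨by rw [hT']; exact hM.1.const_mul _, ?_⟩
  rw [coef, hsum, hT', iterSum_const_mul, hM.2, mul_assoc, mul_inv_cancel_left₀ hF.ne']

/-! ### Nested sums with a finite limit. -/

/-- The box size `N` is kept independent of `m`, so that the induction can lower `m` to `m - k` in
the same box. -/
theorem iterSum_natCast (n m N : ℕ) (hN : m < N) (f : (Fin n → ℕ) → ℝ) :
    iterSum n (m : ℕ∞) f =
      ∑ k : Fin n → Fin N, if ∑ i, (k i : ℕ) ≤ m then f (fun i => k i) else 0 := by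
  induction n generalizing m with
  | zero =>
    simp only [iterSum, Finset.univ_unique, Finset.sum_singleton, Finset.univ_eq_empty,
      Finset.sum_empty, zero_le, if_true]
    congr 1; funext i; exact i.elim0
  | succ n ih =>
    rw [← (Fin.consEquiv fun _ => Fin N).sum_comp, Fintype.sum_prod_type, iterSum,
      tsum_eq_sum (s := Finset.range N) fun k hk => if_neg (by
        simp only [Finset.mem_range, not_lt] at hk; exact_mod_cast (hN.trans_le hk).not_ge),
      ← Fin.sum_univ_eq_sum_range (fun k : ℕ => if (k : ℕ∞) ≤ m then
        iterSum n (m - k) (fun k' => f (Fin.cons k k')) else 0)]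
    refine Finset.sum_congr rfl fun k _ => ?_
    have hval : ∀ k' : Fin n → Fin N, (fun i => (((Fin.cons k k' : Fin (n + 1) → Fin N) i : Fin N) : ℕ)) =
        (Fin.cons (k : ℕ) (fun i => (k' i : ℕ)) : Fin (n + 1) → ℕ) := by
      intro k'; funext i; refine Fin.cases ?_ (fun i => ?_) i <;> simp
    simp only [Fin.consEquiv, Equiv.coe_fn_mk, hval, Fin.sum_univ_succ, Fin.cons_zero, Fin.cons_succ]
    split_ifs with hk
    · have hkm : (k : ℕ) ≤ m := by exact_mod_cast hk
      rw [← ENat.natCast_sub, ih _ (by omega)]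
      refine Finset.sum_congr rfl fun k' _ => ?_
      congr 1
      simp only [eq_iff_iff]; omega
    · have hkm : ¬ (k : ℕ) ≤ m := by exact_mod_cast hk
      refine (Finset.sum_eq_zero fun k' _ => if_neg ?_).symm
      omega

theorem iterSum_natCast_eq_sum_filter (n m : ℕ) (f : (Fin n → ℕ) → ℝ) :
    iterSum n (m : ℕ∞) f = ∑ k ∈ (Fintype.piFinset fun _ : Fin n => Finset.range (m + 1)).filter
      (fun k => ∑ i, k i ≤ m), f k := by
  rw [iterSum_natCast n m (m + 1) m.lt_succ_self, Finset.sum_filter]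
  refine Finset.sum_bij (fun k _ i => (k i : ℕ)) (fun k _ => by simp [Fin.is_le])
    (fun k _ k' _ h => ?_) (fun k hk => ?_) (fun k _ => rfl)
  · funext i; exact Fin.ext (congrFun h i)
  · rw [Fintype.mem_piFinset] at hk
    exact ⟨fun i => ⟨k i, Finset.mem_range.1 (hk i)⟩, Finset.mem_univ _, rfl⟩

/-! ### Sign symmetry: averaging over deterministic coefficients. -/

theorem measurable_gjrAlpha (α lam : ℝ) : Measurable (gjrAlpha α lam) := by
  unfold gjrAlpha
  exact measurable_const.add
    (measurable_const.mul (Measurable.ite measurableSet_Iio measurable_const measurable_const))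

theorem gjrAlpha_pos {α lam : ℝ} (hα : 0 < α) (hlam : 0 ≤ lam) (u : ℝ) : 0 < gjrAlpha α lam u := by
  unfold gjrAlpha
  split_ifs <;> linarith

theorem gjrAlpha_mul_of_pos (α lam : ℝ) {c : ℝ} (hc : 0 < c) (u : ℝ) :
    gjrAlpha α lam (c * u) = gjrAlpha α lam u := by
  simp [gjrAlpha, mul_neg_iff, hc, not_lt.2 hc.le]

/-- Adding the integrals at `e` and `-e`, exactly one of which is negative off a null set, produces
each of `α` and `α + λ` once. -/
theorem two_mul_lintegral_gjrAlpha (α lam : ℝ) {G : ℝ → ENNReal} (hG : Measurable G) :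
    2 * ∫⁻ e, G (gjrAlpha α lam e * e ^ 2) ∂(gaussianReal 0 1) =
      ∑ c : ℤˣ, ∫⁻ e, G ((α + lam / 2 * (1 - ((c : ℤ) : ℝ))) * e ^ 2) ∂(gaussianReal 0 1) := by
  have hm := measurable_gjrAlpha α lam
  have hneg : ∫⁻ e, G (gjrAlpha α lam e * e ^ 2) ∂(gaussianReal 0 1) =
      ∫⁻ e, G (gjrAlpha α lam (-e) * e ^ 2) ∂(gaussianReal 0 1) := by
    conv_lhs => rw [← neg_zero, ← gaussianReal_map_neg, lintegral_map (by fun_prop) (by fun_prop)]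
    simp
  have h0 : ∀ᵐ e ∂(gaussianReal 0 1), e ≠ (0 : ℝ) := by
    have := nullSingletonClass_gaussianReal (μ := 0) (v := 1) one_ne_zero
    exact ae_iff.2 (by simp)
  rw [two_mul]
  nth_rw 2 [hneg]
  rw [← lintegral_add_left (by fun_prop), UnitsInt.univ, Finset.sum_pair (by decide),
    ← lintegral_add_left (by fun_prop)]
  refine lintegral_congr_ae ?_
  filter_upwards [h0] with e he
  rcases lt_or_gt_of_ne he with h | h
  · rw [add_comm]
    simp only [gjrAlpha, h, if_true, Left.neg_neg_iff, not_lt.2 h.le, if_false]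
    norm_num
  · simp only [gjrAlpha, h, if_true, Left.neg_neg_iff, not_lt.2 h.le, if_false]
    norm_num

/-- The ARCH coefficients `α_1, …, α_n` given by the signs `s`, extended by `0`. -/
noncomputable def finSignAlpha (α lam : ℝ) {n : ℕ} (s : Fin n → ℤˣ) (t : ℕ) : ℝ :=
  if ht : 1 ≤ t ∧ t ≤ n then α + lam / 2 * (1 - (((s ⟨t - 1, by omega⟩ : ℤˣ) : ℤ) : ℝ)) else 0

theorem varianceLaw_congr (ω β v : ℝ) {a b : ℕ → ℝ} {n : ℕ} (h : ∀ t, 1 ≤ t → t ≤ n → a t = b t) :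
    varianceLaw ω β v a n = varianceLaw ω β v b n := by
  induction n with
  | zero => simp only [varianceLaw_zero]
  | succ n ih =>
    rw [varianceLaw_succ, varianceLaw_succ, ih fun t h1 h2 => h t h1 (by omega),
      h (n + 1) (by omega) le_rfl]

theorem lintegral_varianceKernel_succ (ω β : ℝ) {a : ℕ → ℝ → ℝ} (ha : ∀ n, Measurable (a n))
    (n : ℕ) (v : ℝ) {g : ℝ → ENNReal} (hg : Measurable g) :
    ∫⁻ u, g u ∂(varianceKernel ω β a (n + 1) v) = ∫⁻ u, ∫⁻ e,
      g (ω + (a (n + 1) e * e ^ 2 + β) * u) ∂(gaussianReal 0 1) ∂(varianceKernel ω β a n v) := by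
  have := isMarkovKernel_varianceKernel ω β ha n
  have hs := measurable_varianceStep ω β (ha (n + 1))
  rw [varianceKernel_succ_apply ω β ha, lintegral_map hg hs,
    lintegral_prod (fun p => g (varianceStep ω β (a (n + 1)) p)) (hg.comp hs).aemeasurable]
  rfl

theorem lintegral_varianceLaw_succ (ω β v : ℝ) (a : ℕ → ℝ) (n : ℕ) {g : ℝ → ENNReal}
    (hg : Measurable g) :
    ∫⁻ u, g u ∂(varianceLaw ω β v a (n + 1)) = ∫⁻ u, ∫⁻ e,
      g (ω + (a (n + 1) * e ^ 2 + β) * u) ∂(gaussianReal 0 1) ∂(varianceLaw ω β v a n) :=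
  lintegral_varianceKernel_succ ω β (fun _ => measurable_const) n v hg

/-- The last innovation is symmetrized with the current variance held fixed; the induction
hypothesis is then applied to the averaged test functions `H c`. -/
theorem two_pow_mul_lintegral_varianceKernel (ω β α lam v : ℝ) (n : ℕ) {g : ℝ → ENNReal}
    (hg : Measurable g) :
    2 ^ n * ∫⁻ u, g u ∂(varianceKernel ω β (fun _ => gjrAlpha α lam) n v) =
      ∑ s : Fin n → ℤˣ, ∫⁻ u, g u ∂(varianceLaw ω β v (finSignAlpha α lam s) n) := by
  induction n generalizing g with
  | zero => simp [varianceLaw_zero, varianceKernel_zero_apply]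
  | succ n ih =>
    have hm := measurable_gjrAlpha α lam
    let H : ℤˣ → ℝ → ENNReal := fun c u => ∫⁻ e,
      g (ω + ((α + lam / 2 * (1 - ((c : ℤ) : ℝ))) * e ^ 2 + β) * u) ∂(gaussianReal 0 1)
    have hH : ∀ c, Measurable (H c) := fun c => by
      simp only [H]; exact Measurable.lintegral_prod_right (by fun_prop)
    have hmeas : Measurable fun u => ∫⁻ e, g (ω + (gjrAlpha α lam e * e ^ 2 + β) * u)
        ∂(gaussianReal 0 1) := Measurable.lintegral_prod_right (by fun_prop)
    rw [lintegral_varianceKernel_succ ω β (fun _ => hm) n v hg, pow_succ, mul_assoc,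
      ← lintegral_const_mul _ hmeas]
    simp_rw [fun u => two_mul_lintegral_gjrAlpha α lam
      (G := fun y => g (ω + (y + β) * u)) (by fun_prop)]
    rw [lintegral_finsetSum _ fun c _ => hH c, Finset.mul_sum]
    simp_rw [fun c => ih (hH c)]
    rw [← (Fin.snocEquiv fun _ => ℤˣ).sum_comp, Fintype.sum_prod_type]
    refine Finset.sum_congr rfl fun c _ => Finset.sum_congr rfl fun s _ => ?_
    rw [lintegral_varianceLaw_succ _ _ _ _ _ hg]
    have h1 : finSignAlpha α lam (Fin.snocEquiv (fun _ => ℤˣ) (c, s)) (n + 1) =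
        α + lam / 2 * (1 - ((c : ℤ) : ℝ)) := by
      have : (⟨n + 1 - 1, by omega⟩ : Fin (n + 1)) = Fin.last n := by ext; simp
      simp [finSignAlpha, Fin.snocEquiv, Fin.snoc]
    rw [h1, varianceLaw_congr ω β v (a := finSignAlpha α lam (Fin.snocEquiv (fun _ => ℤˣ) (c, s)))
      (b := finSignAlpha α lam s)]
    intro t ht1 ht2
    rw [finSignAlpha, finSignAlpha, dif_pos ⟨ht1, by omega⟩, dif_pos ⟨ht1, ht2⟩]
    have : t - 1 < n := by omega
    simp [Fin.snocEquiv, Fin.snoc, this]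

/-- Sign vectors as functions on `Fin (n + 1)`. -/
def signVecEquiv (n : ℕ) : SignVec (n + 2) ≃ (Fin (n + 1) → ℤˣ) :=
  Equiv.arrowCongr
    { toFun := fun t => ⟨t.1 - 1, by have := Finset.mem_Icc.1 t.2; omega⟩
      invFun := fun i => ⟨i + 1, Finset.mem_Icc.2 ⟨by omega, by omega⟩⟩
      left_inv := fun t => by have := Finset.mem_Icc.1 t.2; ext; simp; omega
      right_inv := fun i => by ext; simp }
    (Equiv.refl _)

theorem finSignAlpha_signVecEquiv (α lam : ℝ) {n : ℕ} (s : SignVec (n + 2)) :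
    finSignAlpha α lam (signVecEquiv n s) = signAlpha α lam s := by
  funext t
  by_cases ht : 1 ≤ t ∧ t ≤ n + 1
  · have ht' : t ∈ Finset.Icc 1 (n + 2 - 1) := Finset.mem_Icc.2 ht
    rw [finSignAlpha, signAlpha, dif_pos ht, dif_pos ht']
    simp [signVecEquiv, Nat.sub_add_cancel ht.1]
  · have ht' : t ∉ Finset.Icc 1 (n + 2 - 1) := fun h => ht (Finset.mem_Icc.1 h)
    rw [finSignAlpha, signAlpha, dif_neg ht, dif_neg ht']

theorem varianceKernel_gjrAlpha_eq (ω β α lam v : ℝ) (n : ℕ) :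
    varianceKernel ω β (fun _ => gjrAlpha α lam) (n + 1) v =
      ∑ s : SignVec (n + 2),
        (2 ^ (n + 1) : ENNReal)⁻¹ • varianceLaw ω β v (signAlpha α lam s) (n + 1) := by
  refine Measure.ext_of_lintegral _ fun g hg => ?_
  have h := two_pow_mul_lintegral_varianceKernel ω β α lam v (n + 1) hg
  rw [← (signVecEquiv n).sum_comp] at h
  simp_rw [finSignAlpha_signVecEquiv] at h
  rw [lintegral_finsetSum_measure]
  simp_rw [lintegral_smul_measure, smul_eq_mul]
  rw [← Finset.mul_sum, ← h, ← mul_assoc, ENNReal.inv_mul_cancel (by simp) (by simp), one_mul]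

theorem integral_varianceKernel_gjrAlpha (ω β α lam v : ℝ) (n : ℕ) {g : ℝ → ℝ}
    (hg : ∀ s : SignVec (n + 2),
      Integrable g (varianceLaw ω β v (signAlpha α lam s) (n + 1))) :
    Integrable g (varianceKernel ω β (fun _ => gjrAlpha α lam) (n + 1) v) ∧
    ∫ u, g u ∂(varianceKernel ω β (fun _ => gjrAlpha α lam) (n + 1) v) =
      (2 ^ (n + 1))⁻¹ * ∑ s : SignVec (n + 2),
        ∫ u, g u ∂(varianceLaw ω β v (signAlpha α lam s) (n + 1)) := by
  have hc : (2 ^ (n + 1) : ENNReal)⁻¹ ≠ ⊤ := by simp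
  rw [varianceKernel_gjrAlpha_eq]
  refine ⟨integrable_finsetSum_measure.2 fun s _ => (hg s).smul_measure hc, ?_⟩
  rw [integral_finsetSum_measure fun s _ => (hg s).smul_measure hc]
  simp_rw [integral_smul_measure]
  rw [← Finset.smul_sum]
  simp

/-! ### The conditional law given `(x₀, σ₀)`. -/

theorem indepFun_prodMk_left {Ω A B C : Type*} [MeasurableSpace Ω] [MeasurableSpace A]
    [MeasurableSpace B] [MeasurableSpace C] {μ : Measure Ω} [IsProbabilityMeasure μ]
    {X : Ω → A} {Y : Ω → B} {Z : Ω → C} (hX : Measurable X) (hY : Measurable Y) (hZ : Measurable Z)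
    (h : IndepFun X (fun o => (Y o, Z o)) μ) (hYZ : IndepFun Y Z μ) :
    IndepFun (fun o => (X o, Y o)) Z μ := by
  have hXY : IndepFun X Y μ := h.comp measurable_id measurable_fst
  have : IsProbabilityMeasure (μ.map X) := Measure.isProbabilityMeasure_map hX.aemeasurable
  have : IsProbabilityMeasure (μ.map Y) := Measure.isProbabilityMeasure_map hY.aemeasurable
  have : IsProbabilityMeasure (μ.map Z) := Measure.isProbabilityMeasure_map hZ.aemeasurable
  rw [indepFun_iff_map_prod_eq_prod_map_map (by fun_prop) (by fun_prop)] at h hYZ hXY ⊢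
  rw [hXY, MeasurableEquiv.prodAssoc.map_measurableEquiv_injective.eq_iff.symm,
    Measure.prodAssoc_prod, ← hYZ, ← h, Measure.map_map (by fun_prop) (by fun_prop)]
  rfl

/-- Independence makes the law of `((X, V), e)` a product, so the disintegration over `X` survives
one more step driven by `e`. -/
theorem map_prodMk_eq_compProd_of_indepFun {Ω A : Type*} [MeasurableSpace Ω] [MeasurableSpace A]
    {μ : Measure Ω} [IsProbabilityMeasure μ] {X : Ω → A} {V e : Ω → ℝ} (hX : Measurable X)
    (hV : Measurable V) (he : Measurable e) {κ : Kernel A ℝ} [IsMarkovKernel κ]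
    {γ : Measure ℝ} [IsProbabilityMeasure γ]
    (hκ : μ.map (fun o => (X o, V o)) = μ.map X ⊗ₘ κ) (hind : IndepFun (fun o => (X o, V o)) e μ)
    (hγ : μ.map e = γ) {f : ℝ × ℝ → ℝ} (hf : Measurable f) :
    μ.map (fun o => (X o, f (V o, e o))) = μ.map X ⊗ₘ ((κ ×ₖ Kernel.const A γ).map f) := by
  have : IsProbabilityMeasure (μ.map X) := Measure.isProbabilityMeasure_map hX.aemeasurable
  have := Kernel.IsMarkovKernel.map (κ ×ₖ Kernel.const A γ) hf
  rw [indepFun_iff_map_prod_eq_prod_map_map (by fun_prop) (by fun_prop), hκ, hγ] at hind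
  have h1 : μ.map (fun o => (X o, f (V o, e o))) =
      ((μ.map X ⊗ₘ κ).prod γ).map (fun p => (p.1.1, f (p.1.2, p.2))) := by
    rw [← hind, Measure.map_map (by fun_prop) (by fun_prop)]
    rfl
  rw [h1]
  refine Measure.ext_of_lintegral _ fun g hg => ?_
  rw [lintegral_map hg (by fun_prop),
    lintegral_prod (fun p : (A × ℝ) × ℝ => g (p.1.1, f (p.1.2, p.2)))
      (Measurable.aemeasurable (by fun_prop)),
    Measure.lintegral_compProd (Measurable.lintegral_prod_right (by fun_prop)),
    Measure.lintegral_compProd hg]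
  refine lintegral_congr fun a => ?_
  rw [Kernel.lintegral_map _ hf _ (by fun_prop), Kernel.lintegral_prod _ _ _ (by fun_prop)]
  simp

section GJRGarch

variable {Ω : Type*} [MeasurableSpace Ω] {μ : Measure Ω} {ω α β lam : ℝ}
  {x σ ε : ℕ → Ω → ℝ}

theorem IsGJRGarch.sq_σ_one (hG : IsGJRGarch μ ω α β lam x σ ε) (o : Ω) :
    σ 1 o ^ 2 = sigmaOneSq ω α β lam (x 0 o) (σ 0 o) :=
  hG.σ_succ 0 o

theorem IsGJRGarch.sq_σ_add_two (hG : IsGJRGarch μ ω α β lam x σ ε) (t : ℕ) (o : Ω) :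
    σ (t + 2) o ^ 2 = varianceStep ω β (gjrAlpha α lam) (σ (t + 1) o ^ 2, ε (t + 1) o) := by
  rw [hG.σ_succ, hG.x_succ, gjrAlpha_mul_of_pos _ _ (hG.σ_pos _ _), varianceStep]
  ring

theorem measurable_sigmaOneSq (ω α β lam : ℝ) :
    Measurable fun p : ℝ × ℝ => sigmaOneSq ω α β lam p.1 p.2 := by
  have := measurable_gjrAlpha α lam
  unfold sigmaOneSq
  fun_prop

/-- The variance depends only on the initial pair and `ε_1, …, ε_n`; both its measurability and its
independence from `ε_{n+1}` come from this. -/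
theorem IsGJRGarch.exists_sq_σ_eq (hG : IsGJRGarch μ ω α β lam x σ ε) (n : ℕ) :
    ∃ g : (ℝ × ℝ) × (Finset.range n → ℝ) → ℝ, Measurable g ∧
      ∀ o, σ (n + 1) o ^ 2 = g ((x 0 o, σ 0 o), fun i => ε (i + 1) o) := by
  induction n with
  | zero => exact ⟨fun p => sigmaOneSq ω α β lam p.1.1 p.1.2,
      (measurable_sigmaOneSq ω α β lam).comp measurable_fst, hG.sq_σ_one⟩
  | succ n ih =>
    obtain ⟨g, hg, h⟩ := ih
    have hs := measurable_varianceStep ω β (measurable_gjrAlpha α lam)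
    refine ⟨fun p => varianceStep ω β (gjrAlpha α lam)
      (g (p.1, fun i => p.2 ⟨i, Finset.range_mono n.le_succ i.2⟩),
        p.2 ⟨n, Finset.self_mem_range_succ n⟩), ?_, fun o => ?_⟩
    · fun_prop
    · rw [hG.sq_σ_add_two, h]

theorem IsGJRGarch.measurable_sq_σ (hG : IsGJRGarch μ ω α β lam x σ ε) (n : ℕ) :
    Measurable fun o => σ (n + 1) o ^ 2 := by
  obtain ⟨g, hg, h⟩ := hG.exists_sq_σ_eq n
  have h0 := hG.measurable_x_zero
  have h1 := hG.measurable_σ_zero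
  have h2 := hG.measurable_ε
  simp_rw [h]
  fun_prop

theorem IsGJRGarch.measurable_x_succ (hG : IsGJRGarch μ ω α β lam x σ ε) (n : ℕ) :
    Measurable (x (n + 1)) := by
  -- Only `σ²` is known to be measurable at later times; positivity recovers `σ` as its square root.
  have h : x (n + 1) = fun o => Real.sqrt (σ (n + 1) o ^ 2) * ε (n + 1) o := by
    funext o
    rw [Real.sqrt_sq (hG.σ_pos _ _).le, hG.x_succ]
  rw [h]
  exact (hG.measurable_sq_σ n).sqrt.mul (hG.measurable_ε n)

variable [IsProbabilityMeasure μ]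

theorem IsGJRGarch.indepFun_sq_σ (hG : IsGJRGarch μ ω α β lam x σ ε) (n : ℕ) :
    IndepFun (fun o => ((x 0 o, σ 0 o), σ (n + 1) o ^ 2)) (ε (n + 1)) μ := by
  obtain ⟨g, hg, h⟩ := hG.exists_sq_σ_eq n
  have h0 := hG.measurable_x_zero
  have h1 := hG.measurable_σ_zero
  have h2 := hG.measurable_ε
  have hYZ : IndepFun (fun o (i : Finset.range n) => ε (i + 1) o) (ε (n + 1)) μ :=
    (hG.indep_ε.indepFun_finset (Finset.range n) {n} (by simp) h2).comp measurable_id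
      (ψ := fun e : ({n} : Finset ℕ) → ℝ => e ⟨n, Finset.mem_singleton_self n⟩) (by fun_prop)
  have hX : IndepFun (fun o => (x 0 o, σ 0 o))
      (fun o => ((fun i : Finset.range n => ε (i + 1) o), ε (n + 1) o)) μ :=
    hG.indep_zero.comp measurable_id
      (ψ := fun e : ℕ → ℝ => ((fun i : Finset.range n => e i), e n)) (by fun_prop)
  have := (indepFun_prodMk_left (by fun_prop) (by fun_prop) (by fun_prop) hX hYZ).comp
    (φ := fun p => (p.1, g p)) (by fun_prop) measurable_id
  simp_rw [h]
  exact this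

/-- The law of `σ_{n+1}²` given `(x_0, σ_0)`. -/
noncomputable def gjrVarianceKernel (ω α β lam : ℝ) (n : ℕ) : Kernel (ℝ × ℝ) ℝ :=
  (varianceKernel ω β (fun _ => gjrAlpha α lam) n).comap _ (measurable_sigmaOneSq ω α β lam)

instance (ω α β lam : ℝ) (n : ℕ) : IsMarkovKernel (gjrVarianceKernel ω α β lam n) := by
  have := isMarkovKernel_varianceKernel ω β (a := fun _ => gjrAlpha α lam)
    (fun _ => measurable_gjrAlpha α lam) n
  unfold gjrVarianceKernel
  infer_instance

theorem IsGJRGarch.map_sq_σ (hG : IsGJRGarch μ ω α β lam x σ ε) (n : ℕ) :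
    μ.map (fun o => ((x 0 o, σ 0 o), σ (n + 1) o ^ 2)) =
      μ.map (fun o => (x 0 o, σ 0 o)) ⊗ₘ gjrVarianceKernel ω α β lam n := by
  have h0 := hG.measurable_x_zero
  have h1 := hG.measurable_σ_zero
  induction n with
  | zero =>
    have : gjrVarianceKernel ω α β lam 0 =
        Kernel.deterministic _ (measurable_sigmaOneSq ω α β lam) := by
      ext p : 1
      rw [gjrVarianceKernel, Kernel.comap_apply, varianceKernel_zero_apply,
        Kernel.deterministic_apply]
    rw [this, Measure.compProd_deterministic, Measure.map_map
      (Measurable.prodMk (by fun_prop) (measurable_sigmaOneSq ω α β lam)) (by fun_prop)]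
    simp_rw [zero_add, hG.sq_σ_one]
    rfl
  | succ n ih =>
    have hs := measurable_varianceStep ω β (measurable_gjrAlpha α lam)
    have hk : gjrVarianceKernel ω α β lam (n + 1) = (gjrVarianceKernel ω α β lam n ×ₖ
        Kernel.const _ (gaussianReal 0 1)).map (varianceStep ω β (gjrAlpha α lam)) := by
      ext p : 1
      rw [gjrVarianceKernel, Kernel.comap_apply, varianceKernel_succ_apply _ _
        (fun _ => measurable_gjrAlpha α lam), Kernel.map_apply _ hs, Kernel.prod_apply,
        Kernel.const_apply, gjrVarianceKernel, Kernel.comap_apply]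
    simp_rw [hk, hG.sq_σ_add_two]
    exact map_prodMk_eq_compProd_of_indepFun (by fun_prop) (hG.measurable_sq_σ n)
      (hG.measurable_ε n) ih (hG.indepFun_sq_σ n) (hG.law_ε n) hs

/-- The law of `√V ε`, where `V` has law `ν` and `ε` is an independent standard Gaussian. -/
noncomputable def gaussianMixture (ν : Measure ℝ) : Measure ℝ :=
  (ν.prod (gaussianReal 0 1)).map fun p => Real.sqrt p.1 * p.2

instance (ν : Measure ℝ) [IsProbabilityMeasure ν] : IsProbabilityMeasure (gaussianMixture ν) :=
  Measure.isProbabilityMeasure_map (Measurable.aemeasurable (by fun_prop))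

/-- Almost everywhere uniqueness of the disintegration of the joint law identifies the conditional
distribution. -/
theorem IsGJRGarch.condDistrib_x (hG : IsGJRGarch μ ω α β lam x σ ε) (n : ℕ) :
    ∀ᵐ p ∂(μ.map (fun o => (x 0 o, σ 0 o))),
      condDistrib (x (n + 1)) (fun o => (x 0 o, σ 0 o)) μ p =
        gaussianMixture (varianceKernel ω β (fun _ => gjrAlpha α lam) n
          (sigmaOneSq ω α β lam p.1 p.2)) := by
  have h0 := hG.measurable_x_zero
  have h1 := hG.measurable_σ_zero
  have hs : Measurable fun p : ℝ × ℝ => Real.sqrt p.1 * p.2 := by fun_prop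
  have h := map_prodMk_eq_compProd_of_indepFun (by fun_prop) (hG.measurable_sq_σ n)
    (hG.measurable_ε n) (hG.map_sq_σ n) (hG.indepFun_sq_σ n) (hG.law_ε n) hs
  simp_rw [Real.sqrt_sq (hG.σ_pos _ _).le, ← hG.x_succ] at h
  have := Kernel.IsMarkovKernel.map (gjrVarianceKernel ω α β lam n ×ₖ
    Kernel.const (ℝ × ℝ) (gaussianReal 0 1)) hs
  filter_upwards [condDistrib_ae_eq_of_measure_eq_compProd _
    (hG.measurable_x_succ n).aemeasurable h] with p hp
  rw [hp, Kernel.map_apply _ hs, Kernel.prod_apply, Kernel.const_apply, gjrVarianceKernel,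
    Kernel.comap_apply, gaussianMixture]

theorem IsGJRGarch.condDistrib_sq_x (hG : IsGJRGarch μ ω α β lam x σ ε) (n : ℕ) :
    ∀ᵐ p ∂(μ.map (fun o => (x 0 o, σ 0 o))),
      condDistrib (fun o => x (n + 1) o ^ 2) (fun o => (x 0 o, σ 0 o)) μ p =
        (condDistrib (x (n + 1)) (fun o => (x 0 o, σ 0 o)) μ p).map fun y => y ^ 2 := by
  have hs : Measurable fun y : ℝ => y ^ 2 := by fun_prop
  filter_upwards [condDistrib_comp (fun o => (x 0 o, σ 0 o))
    (hG.measurable_x_succ n).aemeasurable hs] with p hp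
  rw [← Kernel.map_apply _ hs, ← hp]
  rfl

end GJRGarch

/-! ### Gaussian mixtures with variance bounded below. -/

theorem div_sqrt_pow {w : ℝ} (hw : 0 < w) (u : ℝ) (j : ℕ) :
    (u / Real.sqrt w) ^ (2 * j + 1) = u ^ (2 * j + 1) * w ^ (-(1 / 2 : ℝ) - j) := by
  rw [div_pow, div_eq_mul_inv, Real.sqrt_eq_rpow, ← Real.rpow_mul_natCast hw.le,
    ← Real.rpow_neg hw.le]
  congr 2
  push_cast
  ring

section Mixture

variable {ν : Measure ℝ} {ω : ℝ}

theorem gaussianMixture_singleton (hω : 0 < ω) (hν : ∀ᵐ w ∂ν, ω ≤ w) (c : ℝ) :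
    gaussianMixture ν {c} = 0 := by
  have hs : Measurable fun p : ℝ × ℝ => Real.sqrt p.1 * p.2 := by fun_prop
  have := nullSingletonClass_gaussianReal (μ := 0) (v := 1) one_ne_zero
  rw [gaussianMixture, Measure.map_apply hs (measurableSet_singleton c),
    Measure.measure_prod_null (hs (measurableSet_singleton c))]
  filter_upwards [hν] with w hw
  have h0 : 0 < Real.sqrt w := Real.sqrt_pos.2 (hω.trans_le hw)
  refine measure_mono_null (t := {c / Real.sqrt w}) (fun e he => ?_) (measure_singleton _)
  simp only [Set.mem_preimage, Set.mem_singleton_iff] at he ⊢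
  rw [← he]; field_simp

theorem gaussianMixture_real_Iic (hω : 0 < ω) (hν : ∀ᵐ w ∂ν, ω ≤ w) (u : ℝ) :
    (gaussianMixture ν).real (Set.Iic u) =
      ∫ w, (gaussianReal 0 1).real (Set.Iic (u / Real.sqrt w)) ∂ν := by
  have hs : Measurable fun p : ℝ × ℝ => Real.sqrt p.1 * p.2 := by fun_prop
  have hS := hs (measurableSet_Iic (a := u))
  rw [gaussianMixture, map_measureReal_apply hs measurableSet_Iic, measureReal_def,
    Measure.prod_apply hS, ← integral_toReal (measurable_measure_prodMk_left hS).aemeasurable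
      (.of_forall fun _ => measure_lt_top _ _)]
  refine integral_congr_ae ?_
  filter_upwards [hν] with w hw
  have h0 : 0 < Real.sqrt w := Real.sqrt_pos.2 (hω.trans_le hw)
  rw [measureReal_def]
  congr 2
  ext e
  simp [le_div_iff₀ h0, mul_comm]

variable [IsProbabilityMeasure ν]

theorem gaussianMixture_real_Icc (hω : 0 < ω) (hν : ∀ᵐ w ∂ν, ω ≤ w) {a b : ℝ} (hab : a ≤ b) :
    (gaussianMixture ν).real (Set.Icc a b) =
      (gaussianMixture ν).real (Set.Iic b) - (gaussianMixture ν).real (Set.Iic a) := by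
  have h1 : (gaussianMixture ν).real (Set.Icc a b) = (gaussianMixture ν).real (Set.Ioc a b) := by
    refine measureReal_congr (Filter.EventuallyEq.symm ?_)
    refine Ioc_ae_eq_Icc' (gaussianMixture_singleton hω hν a)
  rw [h1, ← Set.Iic_sdiff_Iic, measureReal_sdiff (Set.Iic_subset_Iic.2 hab) measurableSet_Iic]

/-- Each term is largest in absolute value at `w = ω`, where the series is the absolutely convergent
Gaussian one at `u / √ω`; this justifies termwise integration over `ν`. -/
theorem hasSum_gaussianMixture_real_Iic (hω : 0 < ω) (hν : ∀ᵐ w ∂ν, ω ≤ w) (u : ℝ) :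
    HasSum (fun j : ℕ => (2 * Real.pi) ^ (-(1 / 2 : ℝ)) *
        ((-2 : ℝ) ^ (-(j : ℤ)) / (j.factorial * (2 * (j : ℝ) + 1)) * u ^ (2 * j + 1)) *
        ∫ w, w ^ (-(1 / 2 : ℝ) - j) ∂ν)
      ((gaussianMixture ν).real (Set.Iic u) - 1 / 2) := by
  let C : ℕ → ℝ := fun j => (2 * Real.pi) ^ (-(1 / 2 : ℝ)) *
        ((-2 : ℝ) ^ (-(j : ℤ)) / (j.factorial * (2 * (j : ℝ) + 1)) * u ^ (2 * j + 1))
  let F : ℕ → ℝ → ℝ := fun j w => C j * w ^ (-(1 / 2 : ℝ) - j)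
  have hpow : ∀ (j : ℕ) (w : ℝ), 0 < w → F j w = (2 * Real.pi) ^ (-(1 / 2 : ℝ)) *
      ((-2 : ℝ) ^ (-(j : ℤ)) / (j.factorial * (2 * (j : ℝ) + 1)) *
        (u / Real.sqrt w) ^ (2 * j + 1)) := by
    intro j w hw
    simp only [F, C]
    rw [div_sqrt_pow hw]; ring
  have hbound : ∀ j, ∀ᵐ w ∂ν, ‖F j w‖ ≤ |F j ω| := by
    intro j
    filter_upwards [hν] with w hw
    rw [Real.norm_eq_abs, abs_mul (C j), abs_mul (C j),
      abs_of_nonneg (Real.rpow_nonneg (hω.le.trans hw) _),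
      abs_of_nonneg (Real.rpow_nonneg hω.le _)]
    have := Real.rpow_le_rpow_of_nonpos hω hw
      (by have := j.cast_nonneg (α := ℝ); linarith : -(1 / 2 : ℝ) - j ≤ 0)
    gcongr
  have hint : ∀ j, Integrable (F j) ν := fun j =>
    Integrable.of_bound (Measurable.aestronglyMeasurable (by fun_prop)) _ (hbound j)
  have hsum : Summable fun j => ∫ w, ‖F j w‖ ∂ν := by
    have hs : Summable fun j => |F j ω| := by
      refine Summable.abs ?_
      simp_rw [hpow _ ω hω]
      exact (hasSum_gaussianReal_real_Iic _).summable
    refine Summable.of_nonneg_of_le (fun j => integral_nonneg fun _ => norm_nonneg _)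
      (fun j => ?_) hs
    refine (integral_mono_ae (hint j).norm (integrable_const _) (hbound j)).trans ?_
    simp
  have h := hasSum_integral_of_summable_integral_norm hint hsum
  have h1 : ∫ w, ∑' j, F j w ∂ν = (gaussianMixture ν).real (Set.Iic u) - 1 / 2 := by
    have h2 : ∫ w, ∑' j, F j w ∂ν =
        ∫ w, ((gaussianReal 0 1).real (Set.Iic (u / Real.sqrt w)) - 1 / 2) ∂ν := by
      refine integral_congr_ae ?_
      filter_upwards [hν] with w hw
      simp_rw [hpow _ w (hω.trans_le hw)]
      exact (hasSum_gaussianReal_real_Iic _).tsum_eq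
    have hm : Measurable fun w => (gaussianReal 0 1).real (Set.Iic (u / Real.sqrt w)) := by
      have : (fun w => (gaussianReal 0 1).real (Set.Iic (u / Real.sqrt w))) =
          fun w => cdf (gaussianReal 0 1) (u / Real.sqrt w) := by
        funext w; rw [cdf_eq_real]
      rw [this]
      exact (monotone_cdf _).measurable.comp (by fun_prop)
    rw [h2, integral_sub (Integrable.of_bound hm.aestronglyMeasurable 1
      (.of_forall fun w => by rw [Real.norm_of_nonneg measureReal_nonneg]; exact measureReal_le_one))
      (integrable_const _), gaussianMixture_real_Iic hω hν]
    simp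
  rw [← h1]
  simpa only [F, integral_const_mul] using h

theorem integral_gaussianMixture_pow (hω : 0 < ω) (hν : ∀ᵐ w ∂ν, ω ≤ w) (m : ℕ)
    (hm : Integrable (fun w => w ^ m) ν) :
    Integrable (fun y => y ^ (2 * m)) (gaussianMixture ν) ∧
      ∫ y, y ^ (2 * m) ∂(gaussianMixture ν) = (∫ w, w ^ m ∂ν) *
        (2 ^ m * Real.Gamma (m + 1 / 2) / Real.sqrt Real.pi) := by
  have hs : Measurable fun p : ℝ × ℝ => Real.sqrt p.1 * p.2 := by fun_prop
  have hae : (fun p : ℝ × ℝ => (Real.sqrt p.1 * p.2) ^ (2 * m)) =ᵐ[ν.prod (gaussianReal 0 1)]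
      fun p => p.1 ^ m * (p.2 ^ 2) ^ m := by
    have h := Measure.quasiMeasurePreserving_fst (μ := ν) (ν := gaussianReal 0 1) |>.ae hν
    filter_upwards [h] with p hp
    rw [mul_pow, pow_mul, Real.sq_sqrt (hω.le.trans hp), pow_mul]
  have he : Integrable (fun e : ℝ => (e ^ 2) ^ m) (gaussianReal 0 1) := by
    simpa using integrable_gaussianReal_add_mul_sq_pow 0 1 m
  constructor
  · rw [gaussianMixture, integrable_map_measure (by fun_prop) hs.aemeasurable]
    exact (hm.mul_prod he).congr hae.symm
  · rw [gaussianMixture, integral_map hs.aemeasurable (by fun_prop), integral_congr_ae hae,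
      integral_prod_mul (fun w : ℝ => w ^ m) (fun e : ℝ => (e ^ 2) ^ m),
      integral_gaussianReal_pow_even]

end Mixture

/-! ### The condition on `β`, and assembly of the result. -/

/-- With `θ = ω / (2v)`, the bound is the positive root of `β² + 2θβ - 2θ`, which is `(β (ω + βv) -
ω) / v`. -/
theorem lt_of_betaLow_lt {ω β v : ℝ} (hω : 0 < ω) (hβ : 0 < β) (hv : 0 < v)
    (h : betaLow ω v < β) : ω < β * (ω + β * v) := by
  have hθ : 0 < ω / (2 * v) := by positivity
  have h1 : Real.sqrt ((ω / (2 * v)) ^ 2 + 2 * (ω / (2 * v))) < β + ω / (2 * v) := by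
    unfold betaLow at h; linarith
  rw [Real.sqrt_lt' (by positivity)] at h1
  have h2 : ω = 2 * (ω / (2 * v)) * v := by field_simp
  generalize ω / (2 * v) = θ at *
  subst h2
  have := mul_lt_mul_of_pos_right h1 hv
  linarith

theorem lt_mul_varianceLower_of_betaAssumption {ω β v : ℝ} (hω : 0 < ω) (hβ : 0 < β) (hv : 0 < v)
    {n : ℕ} (h : BetaAssumption ω β v (n + 2)) (hne : 2 < n + 2 → β ≠ betaLow ω v) :
    ∀ t, 1 ≤ t → t ≤ n → ω < β * varianceLower ω β v t := by
  refine lt_mul_varianceLower hω hβ (fun hn => ?_) (fun hn => ?_)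
  · refine lt_of_betaLow_lt hω hβ hv (lt_of_le_of_ne ?_ (hne (by omega)).symm)
    rcases hn.eq_or_lt with h1 | h1
    · exact h.1 (by omega)
    · exact (le_max_right _ _).trans (h.2 (by omega))
  · exact (le_max_left _ _).trans (h.2 (by omega))

theorem signAlpha_pos {α lam : ℝ} (hα : 0 < α) (hlam : 0 ≤ lam) {h : ℕ} (s : SignVec h) {t : ℕ}
    (ht : t ∈ Finset.Icc 1 (h - 1)) : 0 < signAlpha α lam s t := by
  rw [signAlpha, dif_pos ht]
  rcases Int.units_eq_one_or (s ⟨t, ht⟩) with h | h <;> rw [h] <;> norm_num <;> linarith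

theorem signAlpha_nonneg {α lam : ℝ} (hα : 0 < α) (hlam : 0 ≤ lam) {h : ℕ} (s : SignVec h)
    (t : ℕ) : 0 ≤ signAlpha α lam s t := by
  by_cases ht : t ∈ Finset.Icc 1 (h - 1)
  · exact (signAlpha_pos hα hlam s ht).le
  · rw [signAlpha, dif_neg ht]

theorem sigmaOneSq_pos {ω α β lam : ℝ} (hω : 0 < ω) (hα : 0 < α) (hβ : 0 < β) (hlam : 0 ≤ lam)
    (x₀ σ₀ : ℝ) : 0 < sigmaOneSq ω α β lam x₀ σ₀ := by
  have := gjrAlpha_pos hα hlam x₀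
  unfold sigmaOneSq
  positivity

theorem varianceLower_succ_ge {ω β v : ℝ} (hω : 0 < ω) (hβ : 0 < β) (hv : 0 < v) (n : ℕ) :
    ω ≤ varianceLower ω β v (n + 1) := by
  have := varianceLower_pos hω hβ hv n
  rw [varianceLower]
  nlinarith

theorem integral_rpow_varianceKernel_gjrAlpha {ω α β lam v : ℝ} (hω : 0 < ω) (hα : 0 < α)
    (hβ : 0 < β) (hlam : 0 ≤ lam) (hv : 0 < v) (n : ℕ) (j : ℝ)
    (hj : (∃ m : ℕ, -(1 / 2) - j = m) ∨
      -(1 / 2) - j < 0 ∧ ∀ t, 1 ≤ t → t ≤ n → ω < β * varianceLower ω β v t) :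
    Integrable (fun w => w ^ (-(1 / 2) - j))
      (varianceKernel ω β (fun _ => gjrAlpha α lam) (n + 1) v) ∧
    ∫ w, w ^ (-(1 / 2) - j) ∂(varianceKernel ω β (fun _ => gjrAlpha α lam) (n + 1) v) =
      (2 ^ (n + 1))⁻¹ * (2 * Real.pi) ^ (-(((n : ℝ) + 1) / 2)) *
        ∑ s : SignVec (n + 2), coef ω β v (n + 2) (signAlpha α lam s) j := by
  have hpi : 0 < (2 * Real.pi) ^ (((n : ℝ) + 1) / 2) := by have := Real.pi_pos; positivity
  have hint : ∀ s : SignVec (n + 2), Integrable (fun w => w ^ (-(1 / 2) - j))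
      (varianceLaw ω β v (signAlpha α lam s) (n + 1)) := by
    intro s
    rcases hj with ⟨m, hm⟩ | ⟨hneg, -⟩
    · simp_rw [hm, Real.rpow_natCast]
      exact integrable_pow_varianceLaw _ _ _ _ _ _
    · refine Integrable.of_bound (Measurable.aestronglyMeasurable (by fun_prop))
        (ω ^ (-(1 / 2) - j)) ?_
      filter_upwards [ae_varianceLower_le_varianceLaw hω hβ hv (signAlpha_nonneg hα hlam s)
        (n + 1)] with w hw
      have hw' := (varianceLower_succ_ge hω hβ hv n).trans hw
      rw [Real.norm_of_nonneg (Real.rpow_nonneg (hω.le.trans hw') _)]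
      exact Real.rpow_le_rpow_of_nonpos hω hw' hneg.le
  have h := integral_varianceKernel_gjrAlpha ω β α lam v n hint
  refine ⟨h.1, ?_⟩
  rw [h.2, mul_assoc, Finset.mul_sum (a := (2 * Real.pi) ^ _)]
  congr 1
  refine Finset.sum_congr rfl fun s _ => ?_
  rw [(iterSummable_coefTerm_and_coef_eq hω hβ hv n (signAlpha_nonneg hα hlam s)
    (fun t ht => signAlpha_pos hα hlam s ht) j hj).2, Real.rpow_neg (by positivity),
    inv_mul_cancel_left₀ hpi.ne']

theorem coef_neg_sub_half_eq (ω β v : ℝ) (n : ℕ) (a : ℕ → ℝ) (m : ℕ) :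
    coef ω β v (n + 2) a (-(m : ℝ) - 1 / 2) = coefFactor ω β v (n + 2) a (-(m : ℝ) - 1 / 2) *
      ∑ k ∈ (Fintype.piFinset fun _ : Fin n => Finset.range (m + 1)).filter
        (fun k => ∑ i, k i ≤ m), coefTerm ω β v (n + 2) a (-(m : ℝ) - 1 / 2) k := by
  rw [coef, show -(1 / 2) - (-(m : ℝ) - 1 / 2) = m by ring, upperLimit_natCast,
    ← iterSum_natCast_eq_sum_filter]
  rfl

theorem tricomi_half_sub_nat {m k : ℕ} (hk : k ≤ m) {ξ : ℝ} (hξ : 0 < ξ) :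
    tricomi (1 / 2) (3 / 2 + (m : ℝ) - k) ξ =
      Real.Gamma ((m : ℝ) + 1 / 2) /
          (Real.sqrt Real.pi * k.factorial * Ring.choose ((m : ℝ) - 1 / 2) k) *
        ξ ^ (-(1 / 2 : ℝ) - m + k) *
        ∑ i ∈ Finset.range (m - k + 1),
          ((m - k).choose i : ℝ) / Ring.choose (-(1 / 2 : ℝ) + m - k) i *
            (ξ ^ i / i.factorial) := by
  have hkm : (k : ℝ) ≤ m := by exact_mod_cast hk
  have h := tricomi_half_add_nat (m - k) hξ
  rw [Nat.cast_sub hk, show (3 / 2 + ((m : ℝ) - k)) = 3 / 2 + (m : ℝ) - k by ring,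
    show -(1 / 2 : ℝ) - (m - k) = -(1 / 2) - m + k by ring,
    show -(1 / 2 : ℝ) + (m - k) = -(1 / 2) + m - k by ring] at h
  rw [h]
  congr 2
  have hg := choose_mul_factorial_mul_Gamma (r := (m : ℝ) - 1 / 2) k (by linarith)
  rw [show (m : ℝ) - 1 / 2 + 1 - k = m - k + 1 / 2 by ring,
    show (m : ℝ) - 1 / 2 + 1 = m + 1 / 2 by ring] at hg
  have hc : Ring.choose ((m : ℝ) - 1 / 2) k ≠ 0 := by
    intro h0
    rw [h0, zero_mul, zero_mul] at hg
    exact (Real.Gamma_pos_of_pos (by positivity : (0 : ℝ) < m + 1 / 2)).ne hg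
  rw [← hg]
  generalize Ring.choose ((m : ℝ) - 1 / 2) k = c at hc ⊢
  field_simp

theorem corollary2 {Ω : Type*} [MeasurableSpace Ω] (μ : Measure Ω) [IsProbabilityMeasure μ]
    (ω α β lam : ℝ) (hω : 0 < ω) (hα : 0 < α) (hβ : 0 < β) (hlam : 0 ≤ lam)
    (x σ ε : ℕ → Ω → ℝ) (hG : IsGJRGarch μ ω α β lam x σ ε) (h : ℕ) (hh : 2 ≤ h) :
    -- for almost every observed value `p = (x₀, σ₀)`
    ∀ᵐ p ∂(μ.map (fun o => (x 0 o, σ 0 o))),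
      -- `v = σ_1²`; `Lx`, `Lz` are the prediction laws of `x_h` and `z_h = x_h²`
      let v : ℝ := sigmaOneSq ω α β lam p.1 p.2
      let Lx : Measure ℝ := condDistrib (x h) (fun o => (x 0 o, σ 0 o)) μ p
      let Lz : Measure ℝ := condDistrib (fun o => x h o ^ 2) (fun o => (x 0 o, σ 0 o)) μ p
      BetaAssumption ω β v h →
        -- the c.d.f.s
        ((2 < h → β ≠ betaLow ω v) →
          (∀ (j : ℕ) (s : SignVec h),
            IterSummable (h - 2) (upperLimit (-(1 / 2) - (j : ℝ)))
              (coefTerm ω β v h (signAlpha α lam s) j)) ∧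
          (∀ w : ℝ, 0 ≤ w →
            Summable (fun j : ℕ => (-2 : ℝ) ^ (-(j : ℤ)) / (j.factorial * ((j : ℝ) + 1 / 2)) *
              w ^ ((j : ℝ) + 1 / 2) * meanCoef ω α β lam v h j) ∧
            cdf Lz w = (2 * Real.pi) ^ (-(h : ℝ) / 2) *
              ∑' j : ℕ, (-2 : ℝ) ^ (-(j : ℤ)) / (j.factorial * ((j : ℝ) + 1 / 2)) *
                w ^ ((j : ℝ) + 1 / 2) * meanCoef ω α β lam v h j) ∧
          (∀ u : ℝ,
            Summable (fun j : ℕ => (-2 : ℝ) ^ (-(j : ℤ)) / (j.factorial * (2 * (j : ℝ) + 1)) *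
              u ^ (2 * j + 1) * meanCoef ω α β lam v h j) ∧
            cdf Lx u = 1 / 2 + (2 * Real.pi) ^ (-(h : ℝ) / 2) *
              ∑' j : ℕ, (-2 : ℝ) ^ (-(j : ℤ)) / (j.factorial * (2 * (j : ℝ) + 1)) *
                u ^ (2 * j + 1) * meanCoef ω α β lam v h j)) ∧
        -- the moments
        (∀ m : ℕ, 1 ≤ m →
          Integrable (fun y : ℝ => y ^ (2 * m)) Lx ∧ Integrable (fun y : ℝ => y ^ m) Lz ∧
          ∫ y, y ^ (2 * m) ∂Lx = ∫ y, y ^ m ∂Lz ∧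
          ∫ y, y ^ m ∂Lz =
            (2 : ℝ) ^ ((m : ℝ) + 3 / 2 - 3 / 2 * (h : ℝ)) * Real.pi ^ (-(h : ℝ) / 2) *
              Real.Gamma ((m : ℝ) + 1 / 2) *
              ∑ s : SignVec h, coef ω β v h (signAlpha α lam s) (-(m : ℝ) - 1 / 2) ∧
          -- the coefficients in the moments are finite sums of Tricomi functions …
          (∀ s : SignVec h, coef ω β v h (signAlpha α lam s) (-(m : ℝ) - 1 / 2) =
            coefFactor ω β v h (signAlpha α lam s) (-(m : ℝ) - 1 / 2) *
              ∑ k ∈ (Fintype.piFinset fun _ : Fin (h - 2) => Finset.range (m + 1)).filter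
                  (fun k => ∑ i, k i ≤ m),
                coefTerm ω β v h (signAlpha α lam s) (-(m : ℝ) - 1 / 2) k) ∧
          -- … and these Tricomi functions are finite sums themselves
          (∀ k : ℕ, k ≤ m → ∀ ξ : ℝ, 0 < ξ →
            tricomi (1 / 2) (3 / 2 + (m : ℝ) - k) ξ =
              Real.Gamma ((m : ℝ) + 1 / 2) /
                  (Real.sqrt Real.pi * k.factorial * Ring.choose ((m : ℝ) - 1 / 2) k) *
                ξ ^ (-(1 / 2 : ℝ) - m + k) *
                ∑ i ∈ Finset.range (m - k + 1),
                  ((m - k).choose i : ℝ) / Ring.choose (-(1 / 2 : ℝ) + m - k) i *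
                    (ξ ^ i / i.factorial))) := by

  obtain ⟨n, rfl⟩ : ∃ n, h = n + 2 := ⟨h - 2, by omega⟩
  filter_upwards [hG.condDistrib_x (n + 1), hG.condDistrib_sq_x (n + 1)] with p hp hp2
  intro v Lx Lz hB
  have hv : 0 < v := sigmaOneSq_pos hω hα hβ hlam _ _
  set ν := varianceKernel ω β (fun _ => gjrAlpha α lam) (n + 1) v with hνdef
  have hmark := isMarkovKernel_varianceKernel ω β (a := fun _ => gjrAlpha α lam)
    (fun _ => measurable_gjrAlpha α lam) (n + 1)
  have hνprob : IsProbabilityMeasure ν := by rw [hνdef]; infer_instance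
  have hν : ∀ᵐ w ∂ν, ω ≤ w := by
    filter_upwards [ae_varianceLower_le hω hβ hv (fun _ => measurable_gjrAlpha α lam)
      (fun _ e => (gjrAlpha_pos hα hlam e).le) (n + 1)] with w hw
    exact (varianceLower_succ_ge hω hβ hv n).trans hw
  have hsq : Measurable fun y : ℝ => y ^ 2 := by fun_prop
  have hLx : Lx = gaussianMixture ν := hp
  have hLz : Lz = (gaussianMixture ν).map fun y => y ^ 2 := by rw [← hLx]; exact hp2
  have hLzprob : IsProbabilityMeasure Lz := by
    rw [hLz]; exact Measure.isProbabilityMeasure_map hsq.aemeasurable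
  have hpi2 : 0 < 2 * Real.pi := by positivity
  refine ⟨fun hne => ?_, fun m hm1 => ?_⟩
  · have hlow := lt_mul_varianceLower_of_betaAssumption hω hβ hv hB hne
    have hj : ∀ j : ℕ, (∃ m : ℕ, -(1 / 2) - (j : ℝ) = m) ∨
        -(1 / 2) - (j : ℝ) < 0 ∧ ∀ t, 1 ≤ t → t ≤ n → ω < β * varianceLower ω β v t := fun j =>
      .inr ⟨by have := j.cast_nonneg (α := ℝ); linarith, hlow⟩
    have hmean : ∀ j : ℕ, ∫ w, w ^ (-(1 / 2 : ℝ) - j) ∂ν =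
        (2 * Real.pi) ^ (-(((n : ℝ) + 1) / 2)) * meanCoef ω α β lam v (n + 2) j := by
      intro j
      rw [(integral_rpow_varianceKernel_gjrAlpha hω hα hβ hlam hv n j (hj j)).2, meanCoef,
        show -((n + 2 : ℕ) : ℝ) + 1 = -((n + 1 : ℕ) : ℝ) by push_cast; ring,
        Real.rpow_neg two_pos.le, Real.rpow_natCast]
      ring
    -- One factor `(2π)^(-1/2)` comes from the density of `ε_h`, the others from the `h - 1` earlier
    -- innovations.
    have hconst : (2 * Real.pi) ^ (-(1 / 2 : ℝ)) * (2 * Real.pi) ^ (-(((n : ℝ) + 1) / 2)) =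
        (2 * Real.pi) ^ (-((n + 2 : ℕ) : ℝ) / 2) := by
      rw [← Real.rpow_add hpi2]; congr 1; push_cast; ring
    have hpos : 0 < (2 * Real.pi) ^ (-((n + 2 : ℕ) : ℝ) / 2) := Real.rpow_pos_of_pos hpi2 _
    have hx : ∀ u : ℝ, HasSum (fun j : ℕ => (2 * Real.pi) ^ (-((n + 2 : ℕ) : ℝ) / 2) *
        ((-2 : ℝ) ^ (-(j : ℤ)) / (j.factorial * (2 * (j : ℝ) + 1)) *
                u ^ (2 * j + 1) * meanCoef ω α β lam v (n + 2) j))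
        ((gaussianMixture ν).real (Set.Iic u) - 1 / 2) := by
      intro u
      convert! hasSum_gaussianMixture_real_Iic hω hν u using 2 with j
      rw [hmean, ← hconst]
      ring
    refine ⟨fun j s => (iterSummable_coefTerm_and_coef_eq hω hβ hv n (signAlpha_nonneg hα hlam s)
      (fun t ht => signAlpha_pos hα hlam s ht) j (hj j)).1, fun w hw => ?_, fun u => ?_⟩
    · have hterm : ∀ j : ℕ, (-2 : ℝ) ^ (-(j : ℤ)) / (j.factorial * ((j : ℝ) + 1 / 2)) *
          w ^ ((j : ℝ) + 1 / 2) * meanCoef ω α β lam v (n + 2) j =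
          2 * ((-2 : ℝ) ^ (-(j : ℤ)) / (j.factorial * (2 * (j : ℝ) + 1)) *
            Real.sqrt w ^ (2 * j + 1) * meanCoef ω α β lam v (n + 2) j) := by
        intro j
        have h1 : Real.sqrt w ^ (2 * j + 1) = w ^ ((j : ℝ) + 1 / 2) := by
          rw [Real.sqrt_eq_rpow, ← Real.rpow_mul_natCast hw]
          congr 1; push_cast; ring
        rw [h1]
        field_simp
      have hs := hx (Real.sqrt w)
      -- The series is odd in `u`, so the mass of `[-√w, √w]` is twice the series at `√w`; the
      -- factor 2 turns `2j + 1` into `j + 1/2`.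
      have hs' := hx (-Real.sqrt w)
      have hodd : ∀ j : ℕ, (-Real.sqrt w) ^ (2 * j + 1) = -Real.sqrt w ^ (2 * j + 1) := fun j =>
        Odd.neg_pow ⟨j, rfl⟩ _
      simp_rw [hodd, mul_neg, neg_mul, mul_neg] at hs'
      have hsymm := hs'.unique hs.neg
      have hsum := (summable_mul_left_iff hpos.ne').1 hs.summable
      simp_rw [hterm]
      refine ⟨hsum.mul_left 2, ?_⟩
      have hpre : (fun y : ℝ => y ^ 2) ⁻¹' Set.Iic w = Set.Icc (-Real.sqrt w) (Real.sqrt w) := by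
        ext y
        simp only [Set.mem_preimage, Set.mem_Iic, Set.mem_Icc]
        rw [Real.sq_le hw]
      have h0 := Real.sqrt_nonneg w
      have htsum := hs.tsum_eq
      rw [tsum_mul_left] at htsum
      rw [cdf_eq_real, hLz, map_measureReal_apply hsq measurableSet_Iic, hpre,
        gaussianMixture_real_Icc hω hν (by linarith), tsum_mul_left]
      linarith
    · have hs := hx u
      refine ⟨(summable_mul_left_iff hpos.ne').1 hs.summable, ?_⟩
      have htsum := hs.tsum_eq
      rw [tsum_mul_left] at htsum
      rw [cdf_eq_real, hLx, htsum]
      ring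
  · have hq : -(1 / 2) - (-(m : ℝ) - 1 / 2) = m := by ring
    have hmom := integral_rpow_varianceKernel_gjrAlpha hω hα hβ hlam hv n (-(m : ℝ) - 1 / 2)
      (.inl ⟨m, hq⟩)
    simp_rw [hq, Real.rpow_natCast] at hmom
    have hgm := integral_gaussianMixture_pow hω hν m hmom.1
    have hpow : ((fun y : ℝ => y ^ m) ∘ fun y => y ^ 2) = fun y => y ^ (2 * m) := by
      funext y; simp [pow_mul]
    have hzx : ∫ y, y ^ m ∂Lz = ∫ y, y ^ (2 * m) ∂(gaussianMixture ν) := by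
      rw [hLz, integral_map hsq.aemeasurable (by fun_prop)]
      simp_rw [pow_mul]
    refine ⟨by rw [hLx]; exact hgm.1, ?_, by rw [hzx, hLx], ?_,
      fun s => coef_neg_sub_half_eq _ _ _ _ _ _, fun k hk ξ hξ => tricomi_half_sub_nat hk hξ⟩
    · rw [hLz, integrable_map_measure (by fun_prop) hsq.aemeasurable, hpow]
      exact hgm.1
    · rw [hzx, hgm.2, hmom.2]
      -- The powers of 2 come from the Gaussian moment, the average over signs and the factor
      -- `(2π)^(-(h-1)/2)`.
      have e1 : (2 : ℝ) ^ ((m : ℝ) + 3 / 2 - 3 / 2 * ((n + 2 : ℕ) : ℝ)) =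
          2 ^ m * ((2 ^ (n + 1))⁻¹ * 2 ^ (-(((n : ℝ) + 1) / 2))) := by
        rw [← Real.rpow_natCast, ← Real.rpow_natCast, ← Real.rpow_neg two_pos.le,
          ← Real.rpow_add two_pos, ← Real.rpow_add two_pos]
        congr 1; push_cast; ring
      have e2 : Real.pi ^ (-((n + 2 : ℕ) : ℝ) / 2) =
          Real.pi ^ (-(((n : ℝ) + 1) / 2)) * (Real.sqrt Real.pi)⁻¹ := by
        rw [Real.sqrt_eq_rpow, ← Real.rpow_neg Real.pi_pos.le, ← Real.rpow_add Real.pi_pos]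
        congr 1; push_cast; ring
      rw [e1, e2, Real.mul_rpow two_pos.le Real.pi_pos.le]
      ring
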